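/- **Definitions.** All objects lie in the Euclidean plane. For two conics $\mathcal C$ (outer) and $\mathcal E$ (inner), a *3-periodic* of the pair $(\mathcal C,\mathcal E)$ is a nondegenerate triangle whose vertices lie on $\mathcal C$ and whose three sidelines are tangent to $\mathcal E$. Write $\mathcal E(a,b)$ for the ellipse $x^2/a^2+y^2/b^2=1$. The *homothetic pair* $(a,b)$, $a,b>0$, consists of the outer ellipse $\mathcal E(a,b)$ and the inner ellipse $\mathcal E(a/2,b/2)$. The *Brocard inellipse* of a triangle is the ellipse tangent to its sidelines at the feet of the cevians through the symmedian point; its *Steiner circumellipse* is the ellipse through its vertices centered at its barycenter. A *Brocard porism pair* $(\mathcal C,\mathcal E)$ consists of the circumcircle $\mathcal C$ and the Brocard inellipse $\mathcal E$ of some triangle. A direct similarity is a map obtained by composing a translation, a rotation and a scaling by a positive factor. **Theorem.** (1) Let $a,b>0$ and put $\beta=\dfrac{\sqrt{3a^4+10a^2b^2+3b^4}}{4ab}$. For $k>0$ let $(a_k,b_k)=(k\beta,k)$, $\mathcal E_k=\mathcal E(a_k,b_k)$, and let $\mathcal C_k$ be the circle with center $\Bigl(0,-\tfrac{1}{b_k}\sqrt{a_k^2-b_k^2}\,\sqrt{4a_k^2-b_k^2}\Bigr)$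 and radius $2a_k^2/b_k$. Then, for every $k>0$, $(\mathcal C_k,\mathcal E_k)$ is a Brocard porism pair; every 3-periodic of the homothetic pair $(a,b)$ is carried by some direct similarity (depending on the triangle) to a 3-periodic of $(\mathcal C_k,\mathcal E_k)$ whose Brocard inellipse is $\mathcal E_k$; and every 3-periodic of $(\mathcal C_k,\mathcal E_k)$ is the image of a 3-periodic of the homothetic pair $(a,b)$ under a direct similarity. (2) Conversely, let $(\mathcal C,\mathcal E)$ be a Brocard porism pair, let $a\ge b>0$ be the semi-axes of $\mathcal E$, and let $\sigma>0$ be given by $$\sigma^2=\frac{8a^2-5b^2+4\sqrt{4a^4-5a^2b^2+b^4}}{3b^2}.$$ Then, for every $k>0$, every 3-periodic of $(\mathcal C,\mathcal E)$ is carried by some direct similarity (depending on the triangle) to a 3-periodic of the homothetic pair $(k\sigma,k)$ whose Steiner circumellipse is $\mathcal E(k\sigma,k)$; and every 3-periodic of the homothetic pair $(k\sigma,k)$ is the image of a 3-periodic of $(\mathcal C,\mathcal E)$ under a direct similarity. -/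

import Mathlib

namespace Porism

noncomputable section

/-- The Euclidean plane. -/
abbrev Plane : Type := EuclideanSpace ℝ (Fin 2)

/-- Counterclockwise rotation about the origin by the angle `θ`. -/
def rot (θ : ℝ) (X : Plane) : Plane :=
  !₂[Real.cos θ * X 0 - Real.sin θ * X 1, Real.sin θ * X 0 + Real.cos θ * X 1]

/-- Orientation-preserving similarities of the plane: a translation, followed by a rotation,
followed by a scaling with positive factor. -/
def IsDirectSimilarity (S : Plane → Plane) : Prop :=
  ∃ s : ℝ, 0 < s ∧ ∃ (θ : ℝ) (V : Plane), ∀ X, S X = s • rot θ (X - V)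

/-- The origin-centred, axis-aligned ellipse with semi-axes `a` (along the first coordinate axis)
and `b` (used for `0 < a`, `0 < b`). -/
def ellipse (a b : ℝ) : Set Plane :=
  {X | (X 0 / a) ^ 2 + (X 1 / b) ^ 2 = 1}

/-- The ellipse with centre `M` and semi-axes `a`, `b`, whose `a`-axis makes the angle `φ` with the
first coordinate axis. -/
def placedEllipse (M : Plane) (φ a b : ℝ) : Set Plane :=
  {X | rot (-φ) (X - M) ∈ ellipse a b}

/-- Triangles are triples of vertices; the `i`-th sideline is the one opposite to vertex `i`. -/
def sideline (P : Fin 3 → Plane) (i : Fin 3) : AffineSubspace ℝ Plane :=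
  line[ℝ, P (i + 1), P (i + 2)]

/-- The line `L` is tangent at `D` to the conic `E` (a circle or an ellipse): `D` is their only
common point. -/
def TangentAt (L : AffineSubspace ℝ Plane) (E : Set Plane) (D : Plane) : Prop :=
  (L : Set Plane) ∩ E = {D}

/-- The 3-periodics of a pair of conics: the nondegenerate triangles inscribed in `outer` all of
whose sidelines are tangent to `inner`. -/
def threePeriodics (outer inner : Set Plane) : Set (Fin 3 → Plane) :=
  {P | AffineIndependent ℝ P ∧ (∀ i, P i ∈ outer) ∧ ∀ i, ∃ D, TangentAt (sideline P i) inner D}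

/-- The 3-periodics of the homothetic pair: outer semi-axes `(a, b)`, inner ones `(a/2, b/2)`. -/
def homotheticFamily (a b : ℝ) : Set (Fin 3 → Plane) :=
  threePeriodics (ellipse a b) (ellipse (a / 2) (b / 2))

/-- The squared length of the side opposite to vertex `i`. -/
def sideSq (P : Fin 3 → Plane) (i : Fin 3) : ℝ :=
  dist (P (i + 1)) (P (i + 2)) ^ 2

/-- The symmedian point `X₆`, whose barycentric coordinates are the squared sidelengths. -/
def symmedianPoint (P : Fin 3 → Plane) : Plane :=
  (∑ i, sideSq P i)⁻¹ • ∑ i, sideSq P i • P i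

/-- `E` is the Brocard inellipse of the triangle `P`: the ellipse tangent to the sidelines at the
feet of the cevians through the symmedian point. -/
def IsBrocardInellipse (P : Fin 3 → Plane) (E : Set Plane) : Prop :=
  (∃ (M : Plane) (φ a b : ℝ), 0 < b ∧ b ≤ a ∧ E = placedEllipse M φ a b) ∧
    ∀ i, ∃ D, D ∈ line[ℝ, P i, symmedianPoint P] ∧ TangentAt (sideline P i) E D

/-- `E` is the Steiner circumellipse of the triangle `P`: the ellipse centred at the barycenter
that passes through the vertices. -/
def IsSteinerCircumellipse (P : Fin 3 → Plane) (E : Set Plane) : Prop :=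
  (∃ φ a b : ℝ, 0 < b ∧ b ≤ a ∧ E = placedEllipse ((3 : ℝ)⁻¹ • ∑ i, P i) φ a b) ∧
    ∀ i, P i ∈ E

/-- `(C, E)` is a Brocard porism pair: `C` is the circumcircle and `E` the Brocard inellipse of some
nondegenerate triangle. -/
def IsBrocardPair (C E : Set Plane) : Prop :=
  (∃ (O : Plane) (R : ℝ), C = Metric.sphere O R) ∧
    ∃ P : Fin 3 → Plane, AffineIndependent ℝ P ∧ (∀ i, P i ∈ C) ∧ IsBrocardInellipse P E

/-- The circle with centre `(0, -c √(4a² - b²) / b)`, `c = √(a² - b²)`, and radius `2a² / b`, which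
is the outer conic over the inellipse `ellipse a b`, where `0 < b ≤ a`. -/
def brocardCircle (a b : ℝ) : Set Plane :=
  Metric.sphere !₂[0, -(√(a ^ 2 - b ^ 2) * √(4 * a ^ 2 - b ^ 2) / b)] (2 * a ^ 2 / b)

/-- The semi-axis ratio of the Brocard inellipses over the homothetic pair `(a, b)`. -/
def betaRatio (a b : ℝ) : ℝ :=
  √(3 * a ^ 4 + 10 * a ^ 2 * b ^ 2 + 3 * b ^ 4) / (4 * a * b)

/-- The semi-axis ratio of the Steiner circumellipses over a Brocard porism whose inellipse has
semi-axes `b ≤ a`. -/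
def sigmaRatio (a b : ℝ) : ℝ :=
  √((8 * a ^ 2 - 5 * b ^ 2 + 4 * √(4 * a ^ 4 - 5 * a ^ 2 * b ^ 2 + b ^ 4)) / (3 * b ^ 2))

end

end Porism

open Porism

namespace Porism

/-! ### Direct similarities -/

/-! Both families are level sets of a single similarity invariant. For a triangle with Brocard angle
ω put κ = (2 cot ω)², the squared ratio of the sum of squared sides to twice the area. Each family
consists of triangles with one fixed κ, and conversely every triangle with that κ can be moved into
the family by a direct similarity. Two families with the same κ therefore correspond, and β and σ
are the axis ratios that make the values agree: 16β² - 4 = κ on one side, 3(σ² + 1)²/σ² = κ on the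
other.

Homothetic side: a triangle is a 3-periodic exactly when its barycenter is the origin and its
second-moment matrix is (3/2) diag(a², b²) (`mem_homotheticFamily_iff`). This gives κ. Conversely,
centring, diagonalizing and scaling any triangle with the right κ puts it in the family
(`exists_map_mem_homotheticFamily`).

Brocard side: in barycentric coordinates the dual conic of an inscribed ellipse has zero diagonal,
since the sidelines are tangent; its off-diagonal entries `h i` are inversely proportional to the
squared sides exactly for the Brocard inellipse. A combination of circumcircle and Brocard inellipse
is the square of a line, which fixes the circle up to a half turn (`IsDualForm.circumcircle_eq`).
For an arbitrary 3-periodic of the standard pair, the products of `h i` with the squared sides are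
positive and have known sum and product; these realize equality in AM-GM, so the products coincide
and κ = 16(a/b)² - 4 (`hasShape_of_mem_threePeriodics`). Every triangle has a Brocard inellipse, and
κ determines its axis ratio (`exists_map_isBrocardInellipse`). -/

theorem plane_ext {X Y : Plane} (h0 : X 0 = Y 0) (h1 : X 1 = Y 1) : X = Y := by
  ext i
  fin_cases i
  · exact h0
  · exact h1

/-- These are the complex maps z ↦ (p + iq)z + (u + iv) with p + iq ≠ 0. This form turns all
transport statements into polynomial identities. -/
theorem isDirectSimilarity_iff {S : Plane → Plane} :
    IsDirectSimilarity S ↔ ∃ p q u v : ℝ, p ^ 2 + q ^ 2 ≠ 0 ∧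
      ∀ X, S X = !₂[p * X 0 - q * X 1 + u, q * X 0 + p * X 1 + v] := by
  constructor
  · rintro ⟨s, hs, θ, V, h⟩
    refine ⟨s * Real.cos θ, s * Real.sin θ, -(s * (Real.cos θ * V 0 - Real.sin θ * V 1)),
      -(s * (Real.sin θ * V 0 + Real.cos θ * V 1)), ?_, ?_⟩
    · have : (s * Real.cos θ) ^ 2 + (s * Real.sin θ) ^ 2 = s ^ 2 := by
        linear_combination s ^ 2 * Real.sin_sq_add_cos_sq θ
      rw [this]
      positivity
    · intro X
      rw [h]
      apply plane_ext <;> simp [rot] <;> ring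
  · rintro ⟨p, q, u, v, h, hS⟩
    have hz : (⟨p, q⟩ : ℂ) ≠ 0 := by
      intro h0
      apply h
      have h1 := congrArg Complex.re h0
      have h2 := congrArg Complex.im h0
      simp at h1 h2
      simp [h1, h2]
    have hc := Complex.norm_mul_cos_arg (⟨p, q⟩ : ℂ)
    have hs := Complex.norm_mul_sin_arg (⟨p, q⟩ : ℂ)
    simp only at hc hs
    refine ⟨‖(⟨p, q⟩ : ℂ)‖, norm_pos_iff.2 hz, Complex.arg ⟨p, q⟩,
      !₂[-(p * u + q * v) / (p ^ 2 + q ^ 2), -(p * v - q * u) / (p ^ 2 + q ^ 2)], ?_⟩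
    intro X
    rw [hS]
    apply plane_ext
    · simp only [rot, PiLp.smul_apply, PiLp.sub_apply, smul_eq_mul, Matrix.cons_val_zero,
        Matrix.cons_val_one, mul_sub, ← mul_assoc, hc, hs]
      field_simp
      ring
    · simp only [rot, PiLp.smul_apply, PiLp.sub_apply, smul_eq_mul, Matrix.cons_val_zero,
        Matrix.cons_val_one, mul_sub, mul_add, ← mul_assoc, hc, hs]
      field_simp
      ring

theorem IsDirectSimilarity.comp {S T : Plane → Plane} (hS : IsDirectSimilarity S)
    (hT : IsDirectSimilarity T) : IsDirectSimilarity (S ∘ T) := by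
  rw [isDirectSimilarity_iff] at *
  obtain ⟨p, q, u, v, h, hS⟩ := hS
  obtain ⟨p', q', u', v', h', hT⟩ := hT
  refine ⟨p * p' - q * q', p * q' + q * p', p * u' - q * v' + u, q * u' + p * v' + v, ?_, ?_⟩
  · have : (p * p' - q * q') ^ 2 + (p * q' + q * p') ^ 2 = (p ^ 2 + q ^ 2) * (p' ^ 2 + q' ^ 2) := by
      ring
    rw [this]
    exact mul_ne_zero h h'
  · intro X
    rw [Function.comp, hS, hT]
    apply plane_ext <;> simp <;> ring

theorem IsDirectSimilarity.exists_inverse {S : Plane → Plane} (hS : IsDirectSimilarity S) :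
    ∃ T, IsDirectSimilarity T ∧ (∀ X, T (S X) = X) ∧ ∀ X, S (T X) = X := by
  obtain ⟨p, q, u, v, h, hS⟩ := isDirectSimilarity_iff.1 hS
  refine ⟨fun X => !₂[p / (p ^ 2 + q ^ 2) * X 0 - -q / (p ^ 2 + q ^ 2) * X 1 +
      -(p * u + q * v) / (p ^ 2 + q ^ 2), -q / (p ^ 2 + q ^ 2) * X 0 + p / (p ^ 2 + q ^ 2) * X 1 +
      (q * u - p * v) / (p ^ 2 + q ^ 2)],
    isDirectSimilarity_iff.2 ⟨_, _, _, _, ?_, fun X => rfl⟩, ?_, ?_⟩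
  · rw [div_pow, div_pow, neg_sq, ← add_div]
    exact div_ne_zero h (pow_ne_zero _ h)
  · intro X
    rw [hS]
    apply plane_ext <;> simp <;> field_simp <;> ring
  · intro X
    rw [hS]
    apply plane_ext <;> simp <;> field_simp <;> ring

theorem dist_sq_eq (X Y : Plane) : dist X Y ^ 2 = (X 0 - Y 0) ^ 2 + (X 1 - Y 1) ^ 2 := by
  rw [EuclideanSpace.dist_eq, Real.sq_sqrt (by positivity)]
  simp [Fin.sum_univ_two, Real.dist_eq, sq_abs]

/-! ### Areas, sides and lines -/

/-- The matrix whose rows are the affine coordinates of the vertices. -/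
def vertexMatrix (P : Fin 3 → Plane) : Matrix (Fin 3) (Fin 3) ℝ :=
  !![P 0 0, P 0 1, 1; P 1 0, P 1 1, 1; P 2 0, P 2 1, 1]

/-- Twice the signed area of a triangle. -/
def doubleArea (P : Fin 3 → Plane) : ℝ := (vertexMatrix P).det

/-- The sum of the squared sidelengths of a triangle. -/
noncomputable def sideSqSum (P : Fin 3 → Plane) : ℝ := sideSq P 0 + sideSq P 1 + sideSq P 2

theorem doubleArea_eq (P : Fin 3 → Plane) :
    doubleArea P = P 0 0 * (P 1 1 - P 2 1) + P 1 0 * (P 2 1 - P 0 1) + P 2 0 * (P 0 1 - P 1 1) := by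
  simp [doubleArea, vertexMatrix, Matrix.det_fin_three]
  ring

theorem sideSq_zero (P : Fin 3 → Plane) :
    sideSq P 0 = (P 1 0 - P 2 0) ^ 2 + (P 1 1 - P 2 1) ^ 2 := dist_sq_eq _ _

theorem sideSq_one (P : Fin 3 → Plane) :
    sideSq P 1 = (P 2 0 - P 0 0) ^ 2 + (P 2 1 - P 0 1) ^ 2 := dist_sq_eq _ _

theorem sideSq_two (P : Fin 3 → Plane) :
    sideSq P 2 = (P 0 0 - P 1 0) ^ 2 + (P 0 1 - P 1 1) ^ 2 := dist_sq_eq _ _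

theorem affineIndependent_iff_doubleArea_ne_zero {P : Fin 3 → Plane} :
    AffineIndependent ℝ P ↔ doubleArea P ≠ 0 := by
  -- The left kernel of the vertex matrix is the space of affine relations among the vertices.
  have key : ∀ w : Fin 3 → ℝ, Matrix.vecMul w (vertexMatrix P) = 0 ↔
      ∑ i, w i = 0 ∧ ∑ i, w i • P i = 0 := by
    intro w
    constructor
    · intro h
      have h0 := congrFun h 0
      have h1 := congrFun h 1
      have h2 := congrFun h 2
      simp [vertexMatrix, Matrix.vecMul, dotProduct, Fin.sum_univ_three] at h0 h1 h2
      refine ⟨by simpa [Fin.sum_univ_three] using h2, ?_⟩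
      apply plane_ext <;> simp [Fin.sum_univ_three, h0, h1]
    · rintro ⟨h2, h⟩
      have h0 := congrArg (fun X : Plane => X 0) h
      have h1 := congrArg (fun X : Plane => X 1) h
      simp [Fin.sum_univ_three] at h0 h1 h2
      ext j
      fin_cases j <;> simp [vertexMatrix, Matrix.vecMul, dotProduct, Fin.sum_univ_three, h0, h1, h2]
  constructor
  · intro hP h0
    obtain ⟨w, hw, hw'⟩ := Matrix.exists_vecMul_eq_zero_iff.2 h0
    obtain ⟨h1, h2⟩ := (key w).1 hw'
    rw [affineIndependent_iff] at hP
    exact hw (funext fun i => hP Finset.univ w h1 h2 i (Finset.mem_univ i))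
  · intro hA
    rw [affineIndependent_iff_of_fintype]
    intro w hw hw' i
    rw [Finset.weightedVSub_eq_linear_combination _ hw] at hw'
    have := Matrix.eq_zero_of_vecMul_eq_zero hA ((key w).2 ⟨hw, hw'⟩)
    simp [this]

theorem mem_line_iff {X P Q : Plane} :
    X ∈ line[ℝ, P, Q] ↔
      ∃ t : ℝ, X 0 = P 0 + t * (Q 0 - P 0) ∧ X 1 = P 1 + t * (Q 1 - P 1) := by
  rw [mem_affineSpan_pair_iff_exists_lineMap_eq]
  refine exists_congr fun t => ?_
  constructor
  · rintro rfl
    simp [AffineMap.lineMap_apply, add_comm]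
  · rintro ⟨h0, h1⟩
    apply plane_ext <;> simp [AffineMap.lineMap_apply, h0, h1, add_comm]

theorem sideSq_pos {P : Fin 3 → Plane} (hP : doubleArea P ≠ 0) (i : Fin 3) : 0 < sideSq P i := by
  have hI := (affineIndependent_iff_doubleArea_ne_zero.2 hP).injective
  have : P (i + 1) ≠ P (i + 2) := fun h => by
    have := hI h
    revert this
    fin_cases i <;> decide
  exact pow_pos (dist_pos.2 this) 2

/-! ### Transport along similarities -/

theorem doubleArea_map {p q u v : ℝ} {S : Plane → Plane}
    (hS : ∀ X, S X = !₂[p * X 0 - q * X 1 + u, q * X 0 + p * X 1 + v]) (P : Fin 3 → Plane) :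
    doubleArea (S ∘ P) = (p ^ 2 + q ^ 2) * doubleArea P := by
  simp [doubleArea_eq, hS]
  ring

theorem sideSq_map {p q u v : ℝ} {S : Plane → Plane}
    (hS : ∀ X, S X = !₂[p * X 0 - q * X 1 + u, q * X 0 + p * X 1 + v]) (P : Fin 3 → Plane)
    (i : Fin 3) : sideSq (S ∘ P) i = (p ^ 2 + q ^ 2) * sideSq P i := by
  simp [sideSq, dist_sq_eq, hS]
  ring

/-- The shape parameter `(2 cot ω)²` of a nondegenerate triangle with Brocard angle `ω` is `κ`. -/
def HasShape (κ : ℝ) (P : Fin 3 → Plane) : Prop :=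
  doubleArea P ≠ 0 ∧ sideSqSum P ^ 2 = κ * doubleArea P ^ 2

theorem hasShape_map {S : Plane → Plane} (hS : IsDirectSimilarity S) {κ : ℝ} {P : Fin 3 → Plane} :
    HasShape κ (S ∘ P) ↔ HasShape κ P := by
  obtain ⟨p, q, u, v, h, hS⟩ := isDirectSimilarity_iff.1 hS
  rw [HasShape, HasShape, sideSqSum, sideSqSum, doubleArea_map hS, sideSq_map hS, sideSq_map hS,
    sideSq_map hS, mul_ne_zero_iff]
  refine and_congr (by simp [h]) ?_
  constructor
  · intro h'
    apply mul_left_cancel₀ (pow_ne_zero 2 h)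
    linear_combination h'
  · intro h'
    linear_combination (p ^ 2 + q ^ 2) ^ 2 * h'

theorem mem_line_map {S : Plane → Plane} (hS : IsDirectSimilarity S) {X P Q : Plane} :
    S X ∈ line[ℝ, S P, S Q] ↔ X ∈ line[ℝ, P, Q] := by
  obtain ⟨p, q, u, v, h, hS⟩ := isDirectSimilarity_iff.1 hS
  rw [mem_line_iff, mem_line_iff]
  refine exists_congr fun t => ?_
  simp only [hS, Matrix.cons_val_zero, Matrix.cons_val_one]
  constructor
  · rintro ⟨h0, h1⟩
    constructor
    · apply mul_left_cancel₀ h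
      linear_combination p * h0 + q * h1
    · apply mul_left_cancel₀ h
      linear_combination p * h1 - q * h0
  · rintro ⟨h0, h1⟩
    constructor
    · linear_combination p * h0 - q * h1
    · linear_combination p * h1 + q * h0

theorem tangentAt_map {S : Plane → Plane} (hS : IsDirectSimilarity S) {P : Fin 3 → Plane}
    {i : Fin 3} {E : Set Plane} {D : Plane} :
    TangentAt (sideline (S ∘ P) i) E (S D) ↔ TangentAt (sideline P i) (S ⁻¹' E) D := by
  obtain ⟨T, hT, hTS, hST⟩ := hS.exists_inverse
  have hmem : ∀ X, S X ∈ sideline (S ∘ P) i ↔ X ∈ sideline P i := fun X => mem_line_map hS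
  have hinj : Function.Injective S := Function.LeftInverse.injective hTS
  simp only [TangentAt, Set.ext_iff, Set.mem_inter_iff, SetLike.mem_coe, Set.mem_singleton_iff,
    Set.mem_preimage]
  constructor
  · intro h X
    rw [← hmem, h, hinj.eq_iff]
  · intro h X
    rw [← hST X, hmem, h, hinj.eq_iff]

theorem affineIndependent_map {S : Plane → Plane} (hS : IsDirectSimilarity S)
    {P : Fin 3 → Plane} : AffineIndependent ℝ (S ∘ P) ↔ AffineIndependent ℝ P := by
  obtain ⟨p, q, u, v, h, hS⟩ := isDirectSimilarity_iff.1 hS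
  rw [affineIndependent_iff_doubleArea_ne_zero, affineIndependent_iff_doubleArea_ne_zero,
    doubleArea_map hS, mul_ne_zero_iff]
  simp [h]

theorem threePeriodics_map {S : Plane → Plane} (hS : IsDirectSimilarity S)
    {P : Fin 3 → Plane} {C E : Set Plane} :
    S ∘ P ∈ threePeriodics C E ↔ P ∈ threePeriodics (S ⁻¹' C) (S ⁻¹' E) := by
  obtain ⟨T, hT, hTS, hST⟩ := hS.exists_inverse
  refine and_congr (affineIndependent_map hS) (and_congr Iff.rfl (forall_congr' fun i => ?_))
  constructor
  · rintro ⟨D, hD⟩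
    rw [← hST D, tangentAt_map hS] at hD
    exact ⟨_, hD⟩
  · rintro ⟨D, hD⟩
    exact ⟨_, (tangentAt_map hS).2 hD⟩

theorem symmedianPoint_map {S : Plane → Plane} (hS : IsDirectSimilarity S) {P : Fin 3 → Plane}
    (hP : doubleArea P ≠ 0) : symmedianPoint (S ∘ P) = S (symmedianPoint P) := by
  obtain ⟨p, q, u, v, h, hS⟩ := isDirectSimilarity_iff.1 hS
  have h0 := sideSq_pos hP 0
  have h1 := sideSq_pos hP 1
  have h2 := sideSq_pos hP 2
  have hL : sideSq P 0 + sideSq P 1 + sideSq P 2 ≠ 0 := by positivity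
  simp only [symmedianPoint, sideSq_map hS, Fin.sum_univ_three, ← mul_add, mul_inv]
  apply plane_ext <;> simp [hS] <;> field_simp <;> ring

theorem brocardFoot_map {S : Plane → Plane} (hS : IsDirectSimilarity S) {P : Fin 3 → Plane}
    (hP : doubleArea P ≠ 0) {E : Set Plane} :
    (∀ i, ∃ D, D ∈ line[ℝ, (S ∘ P) i, symmedianPoint (S ∘ P)] ∧
      TangentAt (sideline (S ∘ P) i) E D) ↔
    ∀ i, ∃ D, D ∈ line[ℝ, P i, symmedianPoint P] ∧ TangentAt (sideline P i) (S ⁻¹' E) D := by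
  obtain ⟨T, hT, hTS, hST⟩ := hS.exists_inverse
  refine forall_congr' fun i => ?_
  rw [symmedianPoint_map hS hP]
  constructor
  · rintro ⟨D, hD, hD'⟩
    rw [← hST D] at hD hD'
    exact ⟨_, (mem_line_map hS).1 hD, (tangentAt_map hS).1 hD'⟩
  · rintro ⟨D, hD, hD'⟩
    exact ⟨_, (mem_line_map hS).2 hD, (tangentAt_map hS).2 hD'⟩

/-! ### Tangents of an ellipse -/

/-- The polar form of the ellipse with semi-axes `a`, `b`. -/
noncomputable def conicForm (a b : ℝ) (X Y : Plane) : ℝ := X 0 * Y 0 / a ^ 2 + X 1 * Y 1 / b ^ 2 - 1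

theorem mem_ellipse_iff {a b : ℝ} {X : Plane} : X ∈ ellipse a b ↔ conicForm a b X X = 0 := by
  rw [ellipse, Set.mem_ofPred_eq, conicForm, sub_eq_zero, div_pow, div_pow, sq (X 0), sq (X 1)]

/-- A line touches the conic at `D` exactly when it is the polar of `D`. On the line the form is a
quadratic with leading coefficient N > 0, and `D` is its only root precisely when the linear term at
`D` vanishes. -/
theorem tangentAt_ellipse_iff {a b : ℝ} (ha : 0 < a) (hb : 0 < b) {P Q D : Plane} (hPQ : P ≠ Q) :
    TangentAt line[ℝ, P, Q] (ellipse a b) D ↔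
      D ∈ line[ℝ, P, Q] ∧ conicForm a b D P = 0 ∧ conicForm a b D Q = 0 := by
  have hN : 0 < (Q 0 - P 0) ^ 2 / a ^ 2 + (Q 1 - P 1) ^ 2 / b ^ 2 := by
    by_cases h0 : Q 0 - P 0 = 0
    · have h1 : Q 1 - P 1 ≠ 0 := fun h1 =>
        hPQ (plane_ext (sub_eq_zero.1 h0).symm (sub_eq_zero.1 h1).symm)
      positivity
    · positivity
  set N := (Q 0 - P 0) ^ 2 / a ^ 2 + (Q 1 - P 1) ^ 2 / b ^ 2 with hNdef
  constructor
  · intro h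
    have hD : D ∈ (line[ℝ, P, Q] : Set Plane) ∩ ellipse a b := by
      rw [show (line[ℝ, P, Q] : Set Plane) ∩ ellipse a b = {D} from h]
      rfl
    have hDD := mem_ellipse_iff.1 hD.2
    obtain ⟨t, h0, h1⟩ := mem_line_iff.1 hD.1
    have hr : conicForm a b D Q - conicForm a b D P = 0 := by
      set r := conicForm a b D Q - conicForm a b D P with hr
      -- By Vieta, -2r/N is the other root of the quadratic measured from `D`; uniqueness of the
      -- common point forces it to be 0.
      let X : Plane := !₂[D 0 + (-2 * r / N) * (Q 0 - P 0), D 1 + (-2 * r / N) * (Q 1 - P 1)]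
      have hX0 : X 0 = D 0 + (-2 * r / N) * (Q 0 - P 0) := rfl
      have hX1 : X 1 = D 1 + (-2 * r / N) * (Q 1 - P 1) := rfl
      have hX : X ∈ (line[ℝ, P, Q] : Set Plane) ∩ ellipse a b := by
        refine ⟨mem_line_iff.2 ⟨t + -2 * r / N, ?_, ?_⟩, mem_ellipse_iff.2 ?_⟩
        · rw [hX0, h0]
          ring
        · rw [hX1, h1]
          ring
        · have : conicForm a b X X =
              conicForm a b D D + 2 * (-2 * r / N) * r + (-2 * r / N) ^ 2 * N := by
            simp only [hX0, hX1, hr, hNdef, conicForm]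
            ring
          rw [this, hDD]
          field_simp
          ring
      rw [show (line[ℝ, P, Q] : Set Plane) ∩ ellipse a b = {D} from h] at hX
      have e0 : X 0 = D 0 := by rw [Set.mem_singleton_iff.1 hX]
      have e1 : X 1 = D 1 := by rw [Set.mem_singleton_iff.1 hX]
      rw [hX0, add_eq_left] at e0
      rw [hX1, add_eq_left] at e1
      have h2 : (-2 * r / N) ^ 2 * N = 0 := by
        rw [hNdef]
        linear_combination (-2 * r / N) * (Q 0 - P 0) / a ^ 2 * e0 +
          (-2 * r / N) * (Q 1 - P 1) / b ^ 2 * e1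
      have h3 : -2 * r / N = 0 := by
        rcases mul_eq_zero.1 h2 with h | h
        · exact pow_eq_zero_iff (two_ne_zero) |>.1 h
        · exact absurd h hN.ne'
      rcases div_eq_zero_iff.1 h3 with h | h
      · linarith
      · exact absurd h hN.ne'
    have hDP : conicForm a b D P + t * (conicForm a b D Q - conicForm a b D P) = 0 := by
      rw [← hDD]
      simp only [conicForm]
      linear_combination (-D 0 / a ^ 2) * h0 + (-D 1 / b ^ 2) * h1
    rw [hr, mul_zero, add_zero] at hDP
    exact ⟨hD.1, hDP, by linarith⟩
  · rintro ⟨hD, hP, hQ⟩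
    obtain ⟨t, h0, h1⟩ := mem_line_iff.1 hD
    have hDD : conicForm a b D D = 0 := by
      have : conicForm a b D D = (1 - t) * conicForm a b D P + t * conicForm a b D Q := by
        simp only [conicForm]
        linear_combination (D 0 / a ^ 2) * h0 + (D 1 / b ^ 2) * h1
      rw [this, hP, hQ]
      ring
    ext X
    constructor
    · rintro ⟨hX, hX'⟩
      obtain ⟨t', h0', h1'⟩ := mem_line_iff.1 hX
      rw [mem_ellipse_iff] at hX'
      have e0 : X 0 = D 0 + (t' - t) * (Q 0 - P 0) := by rw [h0, h0']; ring
      have e1 : X 1 = D 1 + (t' - t) * (Q 1 - P 1) := by rw [h1, h1']; ring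
      have h2 : (t' - t) ^ 2 * N = 0 := by
        have : conicForm a b X X = conicForm a b D D +
            2 * (t' - t) * (conicForm a b D Q - conicForm a b D P) + (t' - t) ^ 2 * N := by
          simp only [hNdef, conicForm, e0, e1]
          ring
        rw [hX', hDD, hP, hQ] at this
        linarith
      have h3 : t' - t = 0 := by
        rcases mul_eq_zero.1 h2 with h | h
        · exact pow_eq_zero_iff (two_ne_zero) |>.1 h
        · exact absurd h hN.ne'
      rw [h3] at e0 e1
      exact plane_ext (by linarith) (by linarith)
    · rintro rfl
      exact ⟨hD, mem_ellipse_iff.2 hDD⟩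

theorem tangentAt_sideline_iff {a b : ℝ} (ha : 0 < a) (hb : 0 < b) {P : Fin 3 → Plane}
    (hP : doubleArea P ≠ 0) {i : Fin 3} {D : Plane} :
    TangentAt (sideline P i) (ellipse a b) D ↔ D ∈ line[ℝ, P (i + 1), P (i + 2)] ∧
      conicForm a b D (P (i + 1)) = 0 ∧ conicForm a b D (P (i + 2)) = 0 := by
  refine tangentAt_ellipse_iff ha hb fun h => ?_
  have := sideSq_pos hP i
  rw [sideSq, h, dist_self] at this
  norm_num at this

open Matrix

/-! ### Gram matrices and their duals -/

/-- Both sides are inverse to each other, with H = -G⁻¹ and E' = E⁻¹; either one forces V to be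
invertible. The left side concerns pairs of vertices, the right side sums over the vertices. -/
theorem gram_eq_iff {V E E' G H : Matrix (Fin 3) (Fin 3) ℝ} (hE : E * E' = 1) (hG : G * H = -1) :
    V * E * Vᵀ = G ↔ Vᵀ * H * V = -E' := by
  have hE' : E' * E = 1 := mul_eq_one_comm.1 hE
  have hG' : H * G = -1 := by
    have : (-G) * H = 1 := by rw [neg_mul, hG, neg_neg]
    have := mul_eq_one_comm.1 this
    rw [mul_neg] at this
    rw [← this, neg_neg]
  constructor
  · intro h
    have h1 : V * (-(E * Vᵀ * H)) = 1 := by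
      rw [mul_neg, ← mul_assoc, ← mul_assoc, h, hG, neg_neg]
    have h2 := mul_eq_one_comm.1 h1
    calc Vᵀ * H * V = E' * E * (Vᵀ * H * V) := by rw [hE', one_mul]
      _ = -(E' * (-(E * Vᵀ * H) * V)) := by simp only [neg_mul, mul_neg, neg_neg, mul_assoc]
      _ = -E' := by rw [h2, mul_one]
  · intro h
    have h1 : (-(E * Vᵀ)) * (H * V) = 1 := by
      rw [neg_mul, mul_assoc, ← mul_assoc (Vᵀ), h, mul_neg, hE, neg_neg]
    have h2 := mul_eq_one_comm.1 h1
    calc V * E * Vᵀ = -(G * H * (V * E * Vᵀ)) := by rw [hG, neg_mul, one_mul, neg_neg]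
      _ = G * (H * V * -(E * Vᵀ)) := by simp only [mul_neg, mul_assoc]
      _ = G := by rw [h2, mul_one]

theorem vertexMatrix_gram (P : Fin 3 → Plane) (e f g : ℝ) (i j : Fin 3) :
    (vertexMatrix P * diagonal ![e, f, g] * (vertexMatrix P)ᵀ) i j =
      e * (P i 0 * P j 0) + f * (P i 1 * P j 1) + g := by
  have h0 : ∀ i, vertexMatrix P i 0 = P i 0 := fun i => by fin_cases i <;> rfl
  have h1 : ∀ i, vertexMatrix P i 1 = P i 1 := fun i => by fin_cases i <;> rfl
  have h2 : ∀ i, vertexMatrix P i 2 = 1 := fun i => by fin_cases i <;> rfl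
  simp [Matrix.mul_apply, Fin.sum_univ_three, h0, h1, h2]
  ring

theorem diagonal_mul_diagonal_inv {a b c : ℝ} (ha : a ≠ 0) (hb : b ≠ 0) (hc : c ≠ 0) :
    diagonal ![1 / a, 1 / b, 1 / c] * diagonal ![a, b, c] = (1 : Matrix (Fin 3) (Fin 3) ℝ) := by
  rw [diagonal_mul_diagonal, ← diagonal_one]
  congr 1
  ext i
  fin_cases i <;> simp [ha, hb, hc]

/-! ### The homothetic family -/

/-- The values 1 and -1/2 are the inner products of an equilateral triangle in the unit circle.
Adding 1/2 to every entry, via the third diagonal entry, gives (3/2) times the identity, whose dual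
statement lists the moments. -/
theorem gram_homothetic_iff {a b : ℝ} (ha : 0 < a) (hb : 0 < b) {P : Fin 3 → Plane} :
    (∀ i j, P i 0 * P j 0 / a ^ 2 + P i 1 * P j 1 / b ^ 2 = if i = j then 1 else -1 / 2) ↔
      P 0 0 + P 1 0 + P 2 0 = 0 ∧ P 0 1 + P 1 1 + P 2 1 = 0 ∧
      P 0 0 * P 0 1 + P 1 0 * P 1 1 + P 2 0 * P 2 1 = 0 ∧
      P 0 0 ^ 2 + P 1 0 ^ 2 + P 2 0 ^ 2 = 3 / 2 * a ^ 2 ∧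
      P 0 1 ^ 2 + P 1 1 ^ 2 + P 2 1 ^ 2 = 3 / 2 * b ^ 2 := by
  have hE := diagonal_mul_diagonal_inv (pow_ne_zero 2 ha.ne') (pow_ne_zero 2 hb.ne')
    (two_ne_zero (α := ℝ))
  have hG : ((3 / 2 : ℝ) • (1 : Matrix (Fin 3) (Fin 3) ℝ)) * ((-2 / 3 : ℝ) • 1) = -1 := by
    rw [smul_mul_smul_comm, one_mul, ← neg_one_smul ℝ (1 : Matrix (Fin 3) (Fin 3) ℝ)]
    norm_num
  have key := gram_eq_iff (V := vertexMatrix P) hE hG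
  have h1 : (∀ i j, P i 0 * P j 0 / a ^ 2 + P i 1 * P j 1 / b ^ 2 = if i = j then 1 else -1 / 2) ↔
      vertexMatrix P * diagonal ![1 / a ^ 2, 1 / b ^ 2, 1 / 2] * (vertexMatrix P)ᵀ =
        (3 / 2 : ℝ) • 1 := by
    rw [← Matrix.ext_iff]
    refine forall_congr' fun i => forall_congr' fun j => ?_
    rw [vertexMatrix_gram, Matrix.smul_apply, one_apply]
    split_ifs
    · rw [smul_eq_mul]
      constructor <;> intro h <;> linear_combination h
    · rw [smul_eq_mul]
      constructor <;> intro h <;> linear_combination h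
  rw [h1, key, ← Matrix.ext_iff]
  constructor
  · intro h
    have h00 := h 0 0
    have h01 := h 0 1
    have h11 := h 1 1
    have h02 := h 0 2
    have h12 := h 1 2
    simp [vertexMatrix, Matrix.mul_apply, Fin.sum_univ_three] at h00 h01 h11 h02 h12
    refine ⟨?_, ?_, ?_, ?_, ?_⟩ <;> linarith
  · rintro ⟨hx, hy, hxy, hxx, hyy⟩ i j
    fin_cases i <;> fin_cases j <;>
      simp [vertexMatrix, Matrix.mul_apply, Fin.sum_univ_three] <;> linarith

theorem doubleArea_sq_eq (P : Fin 3 → Plane) (hx : P 0 0 + P 1 0 + P 2 0 = 0)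
    (hy : P 0 1 + P 1 1 + P 2 1 = 0) :
    doubleArea P ^ 2 = 3 * ((P 0 0 ^ 2 + P 1 0 ^ 2 + P 2 0 ^ 2) *
      (P 0 1 ^ 2 + P 1 1 ^ 2 + P 2 1 ^ 2) - (P 0 0 * P 0 1 + P 1 0 * P 1 1 + P 2 0 * P 2 1) ^ 2) := by
  have h2 : P 2 0 = -P 0 0 - P 1 0 := by linarith
  have h3 : P 2 1 = -P 0 1 - P 1 1 := by linarith
  rw [doubleArea_eq, h2, h3]
  ring

theorem sideSqSum_eq (P : Fin 3 → Plane) (hx : P 0 0 + P 1 0 + P 2 0 = 0)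
    (hy : P 0 1 + P 1 1 + P 2 1 = 0) :
    sideSqSum P = 3 * ((P 0 0 ^ 2 + P 1 0 ^ 2 + P 2 0 ^ 2) +
      (P 0 1 ^ 2 + P 1 1 ^ 2 + P 2 1 ^ 2)) := by
  have h2 : P 2 0 = -P 0 0 - P 1 0 := by linarith
  have h3 : P 2 1 = -P 0 1 - P 1 1 := by linarith
  rw [sideSqSum, sideSq_zero, sideSq_one, sideSq_two, h2, h3]
  ring

theorem conicForm_half (a b : ℝ) (X Y : Plane) :
    conicForm (a / 2) (b / 2) X Y = 4 * (X 0 * Y 0 / a ^ 2 + X 1 * Y 1 / b ^ 2) - 1 := by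
  rw [conicForm, div_pow, div_pow, div_div_eq_mul_div, div_div_eq_mul_div]
  ring

/-- The contact point of a tangent `PQ`, as a point of the line through `P` and `Q`. -/
theorem exists_contact_parameter {a b : ℝ} {P Q D : Plane} (hD : D ∈ line[ℝ, P, Q])
    (hDP : conicForm a b D P = 0) (hDQ : conicForm a b D Q = 0) :
    ∃ t : ℝ, (1 - t) * conicForm a b P P + t * conicForm a b P Q = 0 ∧
      (1 - t) * conicForm a b P Q + t * conicForm a b Q Q = 0 ∧
      D 0 = P 0 + t * (Q 0 - P 0) ∧ D 1 = P 1 + t * (Q 1 - P 1) := by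
  obtain ⟨t, h0, h1⟩ := mem_line_iff.1 hD
  refine ⟨t, ?_, ?_, h0, h1⟩
  · rw [← hDP]
    simp only [conicForm, h0, h1]
    ring
  · rw [← hDQ]
    simp only [conicForm, h0, h1]
    ring

theorem mem_homotheticFamily_iff {a b : ℝ} (ha : 0 < a) (hb : 0 < b) {P : Fin 3 → Plane} :
    P ∈ homotheticFamily a b ↔
      P 0 0 + P 1 0 + P 2 0 = 0 ∧ P 0 1 + P 1 1 + P 2 1 = 0 ∧
      P 0 0 * P 0 1 + P 1 0 * P 1 1 + P 2 0 * P 2 1 = 0 ∧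
      P 0 0 ^ 2 + P 1 0 ^ 2 + P 2 0 ^ 2 = 3 / 2 * a ^ 2 ∧
      P 0 1 ^ 2 + P 1 1 ^ 2 + P 2 1 ^ 2 = 3 / 2 * b ^ 2 := by
  rw [← gram_homothetic_iff ha hb]
  constructor
  · rintro ⟨hI, hO, hT⟩
    have hA := affineIndependent_iff_doubleArea_ne_zero.1 hI
    have hself : ∀ i, P i 0 * P i 0 / a ^ 2 + P i 1 * P i 1 / b ^ 2 = 1 := by
      intro i
      have := mem_ellipse_iff.1 (hO i)
      rw [conicForm] at this
      linarith
    have hpair : ∀ i, P (i + 1) 0 * P (i + 2) 0 / a ^ 2 + P (i + 1) 1 * P (i + 2) 1 / b ^ 2 =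
        -1 / 2 := by
      intro i
      obtain ⟨D, hD⟩ := hT i
      obtain ⟨h1, h2, h3⟩ := (tangentAt_sideline_iff (half_pos ha) (half_pos hb) hA).1 hD
      obtain ⟨t, e1, e2, -, -⟩ := exists_contact_parameter h1 h2 h3
      have hs := sideSq_pos hA i
      have q1 := hself (i + 1)
      have q2 := hself (i + 2)
      rw [conicForm_half, conicForm_half, q1] at e1
      rw [conicForm_half, conicForm_half, q2] at e2
      have hne : P (i + 1) 0 * P (i + 2) 0 / a ^ 2 + P (i + 1) 1 * P (i + 2) 1 / b ^ 2 ≠ 1 := by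
        intro hu
        have e : (P (i + 1) 0 - P (i + 2) 0) ^ 2 / a ^ 2 +
            (P (i + 1) 1 - P (i + 2) 1) ^ 2 / b ^ 2 = 0 := by
          linear_combination q1 + q2 - 2 * hu
        have f1 : 0 ≤ (P (i + 1) 0 - P (i + 2) 0) ^ 2 / a ^ 2 := by positivity
        have f2 : 0 ≤ (P (i + 1) 1 - P (i + 2) 1) ^ 2 / b ^ 2 := by positivity
        have g1 : (P (i + 1) 0 - P (i + 2) 0) ^ 2 / a ^ 2 = 0 := by linarith
        have g2 : (P (i + 1) 1 - P (i + 2) 1) ^ 2 / b ^ 2 = 0 := by linarith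
        rw [div_eq_zero_iff, or_iff_left (pow_ne_zero 2 ha.ne')] at g1
        rw [div_eq_zero_iff, or_iff_left (pow_ne_zero 2 hb.ne')] at g2
        rw [sideSq, dist_sq_eq, g1, g2] at hs
        norm_num at hs
      set u := P (i + 1) 0 * P (i + 2) 0 / a ^ 2 + P (i + 1) 1 * P (i + 2) 1 / b ^ 2
      -- The contact equations are a 2×2 system with nonzero solution (1 - t, t) and matrix entries
      -- 3 and 4u - 1, so its determinant 9 - (4u - 1)² vanishes. The root u = 1 would make two
      -- vertices coincide.
      have h4 : (u - 1) * (u + 1 / 2) = 0 := by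
        have h5 : t * ((u - 1) * (u + 1 / 2)) = 0 := by
          linear_combination (4 * u - 1) / 16 * e1 - 3 / 16 * e2
        have h6 : (1 - t) * ((u - 1) * (u + 1 / 2)) = 0 := by
          linear_combination (4 * u - 1) / 16 * e2 - 3 / 16 * e1
        linear_combination h5 + h6
      rcases mul_eq_zero.1 h4 with h | h
      · exact absurd (sub_eq_zero.1 h) hne
      · linarith
    have p0 := hpair 0
    have p1 := hpair 1
    have p2 := hpair 2
    simp only [Fin.isValue, zero_add, show (1 : Fin 3) + 1 = 2 from rfl,
      show (1 : Fin 3) + 2 = 0 from rfl, show (2 : Fin 3) + 1 = 0 from rfl,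
      show (2 : Fin 3) + 2 = 1 from rfl] at p0 p1 p2
    intro i j
    fin_cases i <;> fin_cases j <;> simp [hself] <;>
      first | linear_combination p0 | linear_combination p1 | linear_combination p2
  · intro h
    have hm := (gram_homothetic_iff ha hb).1 h
    have hA : doubleArea P ≠ 0 := by
      have := doubleArea_sq_eq P hm.1 hm.2.1
      rw [hm.2.2.1, hm.2.2.2.1, hm.2.2.2.2] at this
      intro h0
      rw [h0] at this
      have : 0 < a ^ 2 * b ^ 2 := by positivity
      linarith
    refine ⟨affineIndependent_iff_doubleArea_ne_zero.2 hA, fun i => ?_, fun i => ?_⟩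
    · rw [mem_ellipse_iff, conicForm, h]
      simp
    · have q1 := h (i + 1) (i + 1)
      have q2 := h (i + 2) (i + 2)
      have q3 := h (i + 1) (i + 2)
      rw [if_pos rfl] at q1 q2
      rw [if_neg (by fin_cases i <;> decide)] at q3
      -- The contact points are the midpoints of the sides.
      refine ⟨!₂[(P (i + 1) 0 + P (i + 2) 0) / 2, (P (i + 1) 1 + P (i + 2) 1) / 2],
        (tangentAt_sideline_iff (half_pos ha) (half_pos hb) hA).2
        ⟨mem_line_iff.2 ⟨1 / 2, ?_, ?_⟩, ?_, ?_⟩⟩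
      · simp
        ring
      · simp
        ring
      · rw [conicForm_half]
        simp
        linear_combination 2 * q1 + 2 * q3
      · rw [conicForm_half]
        simp
        linear_combination 2 * q2 + 2 * q3

theorem hasShape_of_mem_homotheticFamily {a b : ℝ} (ha : 0 < a) (hb : 0 < b) {P : Fin 3 → Plane}
    (hP : P ∈ homotheticFamily a b) : HasShape (3 * (a ^ 2 + b ^ 2) ^ 2 / (a ^ 2 * b ^ 2)) P := by
  refine ⟨affineIndependent_iff_doubleArea_ne_zero.1 hP.1, ?_⟩
  obtain ⟨hx, hy, hxy, hxx, hyy⟩ := (mem_homotheticFamily_iff ha hb).1 hP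
  rw [doubleArea_sq_eq P hx hy, sideSqSum_eq P hx hy, hxx, hyy, hxy]
  field_simp
  ring

/-! ### Diagonalization by a rotation -/

/-- The trace-free part of the symmetric matrix with entries p, q, r is the complex number (p - r)/2
+ iq, and a rotation by θ multiplies it by exp(2iθ). Rotating by minus half its argument makes it
real and nonnegative, which also orders the diagonal entries. -/
theorem exists_rotation_diagonal (p q r : ℝ) : ∃ c s : ℝ, c ^ 2 + s ^ 2 = 1 ∧
    c * s * (p - r) + (c ^ 2 - s ^ 2) * q = 0 ∧
    s ^ 2 * p + 2 * c * s * q + c ^ 2 * r ≤ c ^ 2 * p - 2 * c * s * q + s ^ 2 * r := by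
  set z : ℂ := ⟨(p - r) / 2, q⟩ with hz
  have hc := Complex.norm_mul_cos_arg z
  have hs := Complex.norm_mul_sin_arg z
  set φ := Complex.arg z with hφ
  have hc2 : Real.cos φ = 2 * Real.cos (φ / 2) ^ 2 - 1 := by
    rw [← Real.cos_two_mul]
    ring_nf
  have hs2 : Real.sin φ = 2 * Real.sin (φ / 2) * Real.cos (φ / 2) := by
    rw [← Real.sin_two_mul]
    ring_nf
  have h1 := Real.sin_sq_add_cos_sq (φ / 2)
  have hn : 0 ≤ ‖z‖ := norm_nonneg z
  rw [hc2] at hc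
  rw [hs2] at hs
  change _ = (p - r) / 2 at hc
  change _ = q at hs
  set n := ‖z‖
  set C := Real.cos (φ / 2)
  set D := Real.sin (φ / 2)
  have hD : D ^ 2 = 1 - C ^ 2 := by linarith
  refine ⟨C, -D, by linarith, ?_, ?_⟩
  · linear_combination 2 * C * D * hc - (C ^ 2 - D ^ 2) * hs - 2 * n * C * D * hD
  · have : C ^ 2 * p - 2 * C * -D * q + (-D) ^ 2 * r -
        ((-D) ^ 2 * p + 2 * C * -D * q + C ^ 2 * r) = 2 * n := by
      have e1 : p - r = 2 * (n * (2 * C ^ 2 - 1)) := by linarith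
      have e2 : q = n * (2 * D * C) := by linarith
      have : C ^ 2 * p - 2 * C * -D * q + (-D) ^ 2 * r -
        ((-D) ^ 2 * p + 2 * C * -D * q + C ^ 2 * r) = (C ^ 2 - D ^ 2) * (p - r) + 4 * C * D * q := by
        ring
      rw [this, e1, e2]
      linear_combination (-2 * n * (2 * C ^ 2 - 1) + 8 * C ^ 2 * n) * hD
    linarith

/-- The diagonal entries can be ordered like `a` and `b`; for a ≤ b the matrix is negated first. -/
theorem exists_rotation_diagonal_of_le {p q r a b : ℝ} : ∃ c s : ℝ, c ^ 2 + s ^ 2 = 1 ∧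
    c * s * (p - r) + (c ^ 2 - s ^ 2) * q = 0 ∧
    0 ≤ (c ^ 2 * p - 2 * c * s * q + s ^ 2 * r - (s ^ 2 * p + 2 * c * s * q + c ^ 2 * r)) *
      (a - b) := by
  rcases le_total b a with h | h
  · obtain ⟨c, s, h1, h2, h3⟩ := exists_rotation_diagonal p q r
    exact ⟨c, s, h1, h2, mul_nonneg (sub_nonneg.2 h3) (sub_nonneg.2 h)⟩
  · obtain ⟨c, s, h1, h2, h3⟩ := exists_rotation_diagonal (-p) (-q) (-r)
    exact ⟨c, s, h1, by linarith, mul_nonneg_of_nonpos_of_nonpos (by linarith) (by linarith)⟩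

theorem exists_map_mem_homotheticFamily {a b : ℝ} (ha : 0 < a) (hb : 0 < b) {P : Fin 3 → Plane}
    (hP : HasShape (3 * (a ^ 2 + b ^ 2) ^ 2 / (a ^ 2 * b ^ 2)) P) :
    ∃ S, IsDirectSimilarity S ∧ S ∘ P ∈ homotheticFamily a b := by
  set mx := (P 0 0 + P 1 0 + P 2 0) / 3 with hmx
  set my := (P 0 1 + P 1 1 + P 2 1) / 3 with hmy
  set p := (P 0 0 - mx) ^ 2 + (P 1 0 - mx) ^ 2 + (P 2 0 - mx) ^ 2 with hp
  set r := (P 0 1 - my) ^ 2 + (P 1 1 - my) ^ 2 + (P 2 1 - my) ^ 2 with hr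
  set q := (P 0 0 - mx) * (P 0 1 - my) + (P 1 0 - mx) * (P 1 1 - my) +
    (P 2 0 - mx) * (P 2 1 - my) with hq
  obtain ⟨c, s, hcs, hoff, hord⟩ := exists_rotation_diagonal_of_le (p := p) (q := q) (r := r)
    (a := a) (b := b)
  let S : Plane → Plane := fun X =>
    !₂[c * X 0 - s * X 1 + (-(c * mx) + s * my), s * X 0 + c * X 1 + (-(s * mx) - c * my)]
  have hS : IsDirectSimilarity S :=
    isDirectSimilarity_iff.2 ⟨c, s, _, _, by rw [hcs]; exact one_ne_zero, fun X => rfl⟩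
  set Q := S ∘ P with hQdef
  have hQ := (hasShape_map hS).2 hP
  have Q0 : ∀ i, Q i 0 = c * (P i 0 - mx) - s * (P i 1 - my) := fun i => by
    simp [Q, S]; ring
  have Q1 : ∀ i, Q i 1 = s * (P i 0 - mx) + c * (P i 1 - my) := fun i => by
    simp [Q, S]; ring
  have hx : Q 0 0 + Q 1 0 + Q 2 0 = 0 := by
    simp only [Q0]; linear_combination 3 * s * hmy - 3 * c * hmx
  have hy : Q 0 1 + Q 1 1 + Q 2 1 = 0 := by
    simp only [Q1]; linear_combination -3 * s * hmx - 3 * c * hmy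
  have hxy : Q 0 0 * Q 0 1 + Q 1 0 * Q 1 1 + Q 2 0 * Q 2 1 = 0 := by
    rw [← hoff, hp, hq, hr]
    simp only [Q0, Q1]; ring
  have hxx : Q 0 0 ^ 2 + Q 1 0 ^ 2 + Q 2 0 ^ 2 = c ^ 2 * p - 2 * c * s * q + s ^ 2 * r := by
    rw [hp, hq, hr]
    simp only [Q0]; ring
  have hyy : Q 0 1 ^ 2 + Q 1 1 ^ 2 + Q 2 1 ^ 2 = s ^ 2 * p + 2 * c * s * q + c ^ 2 * r := by
    rw [hp, hq, hr]
    simp only [Q1]; ring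
  rw [← hxx, ← hyy] at hord
  set p' := Q 0 0 ^ 2 + Q 1 0 ^ 2 + Q 2 0 ^ 2
  set r' := Q 0 1 ^ 2 + Q 1 1 ^ 2 + Q 2 1 ^ 2
  have hA2 := doubleArea_sq_eq Q hx hy
  rw [hxy] at hA2
  have hApos : 0 < doubleArea Q ^ 2 := by
    have := hQ.1
    positivity
  have hprod : 0 < p' * r' := by linarith
  have hp0 : 0 ≤ p' := by positivity
  have hp' : 0 < p' := lt_of_le_of_ne hp0 fun h => by rw [← h, zero_mul] at hprod; exact hprod.false
  have hr' : 0 < r' := pos_of_mul_pos_right hprod hp0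
  have hL := hQ.2
  rw [sideSqSum_eq Q hx hy, hA2, div_mul_eq_mul_div, eq_div_iff (by positivity)] at hL
  change (3 * (p' + r')) ^ 2 * _ = _ * (3 * (p' * r' - 0 ^ 2)) at hL
  -- Equality of κ says p'/r' + r'/p' = a²/b² + b²/a², so p'/r' is a²/b² or its inverse. The chosen
  -- order of the moments excludes the inverse unless a = b.
  have hfac : (p' * b ^ 2 - r' * a ^ 2) * (p' * a ^ 2 - r' * b ^ 2) = 0 := by
    linear_combination hL / 9
  have hratio : p' * b ^ 2 = r' * a ^ 2 := by
    rcases mul_eq_zero.1 hfac with h | h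
    · linarith
    · have h1 : (p' - r') * a ^ 2 = r' * (b - a) * (b + a) := by linear_combination h
      have h2 : (p' - r') * (a - b) * a ^ 2 = -(r' * (b + a) * (a - b) ^ 2) := by
        linear_combination (a - b) * h1
      have h3 : 0 ≤ (p' - r') * (a - b) * a ^ 2 := by positivity
      have h4 : 0 ≤ r' * (b + a) * (a - b) ^ 2 := by positivity
      have h5 : r' * (b + a) * (a - b) ^ 2 = 0 := by linarith
      have h6 : (a - b) ^ 2 = 0 := by
        rcases mul_eq_zero.1 h5 with h | h
        · exact absurd h (by positivity)
        · exact h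
      have h7 : a = b := sub_eq_zero.1 (pow_eq_zero_iff two_ne_zero |>.1 h6)
      rw [h7] at h ⊢
      linarith
  set k := √(3 / 2 * a ^ 2 / p') with hk
  have hk2 : k ^ 2 = 3 / 2 * a ^ 2 / p' := Real.sq_sqrt (by positivity)
  have hk0 : 0 < k := Real.sqrt_pos.2 (by positivity)
  let T : Plane → Plane := fun X => !₂[k * X 0 - 0 * X 1 + 0, 0 * X 0 + k * X 1 + 0]
  have hT : IsDirectSimilarity T :=
    isDirectSimilarity_iff.2 ⟨k, 0, 0, 0, by positivity, fun X => rfl⟩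
  refine ⟨T ∘ S, hT.comp hS, (mem_homotheticFamily_iff ha hb).2 ?_⟩
  have T0 : ∀ i, ((T ∘ S) ∘ P) i 0 = k * Q i 0 := fun i => by simp [T, Q]
  have T1 : ∀ i, ((T ∘ S) ∘ P) i 1 = k * Q i 1 := fun i => by simp [T, Q]
  simp only [T0, T1]
  refine ⟨?_, ?_, ?_, ?_, ?_⟩
  · linear_combination k * hx
  · linear_combination k * hy
  · linear_combination k ^ 2 * hxy
  · have : k ^ 2 * p' = 3 / 2 * a ^ 2 := by rw [hk2]; field_simp
    linear_combination this
  · have : k ^ 2 * r' = 3 / 2 * b ^ 2 := by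
      rw [hk2]
      field_simp
      linear_combination -hratio
    linear_combination this

/-! ### The dual form of an inscribed ellipse in barycentric coordinates -/

/-- The symmetric matrix with zero diagonal and off-diagonal entries `h 0`, `h 1`, `h 2`. -/
def hollowMatrix (h : Fin 3 → ℝ) : Matrix (Fin 3) (Fin 3) ℝ :=
  !![0, h 2, h 1; h 2, 0, h 0; h 1, h 0, 0]

/-- The dual form of `ellipse a b`, in barycentric coordinates with respect to `P`, is the hollow
matrix with entries `h`. -/
def IsDualForm (a b : ℝ) (P : Fin 3 → Plane) (h : Fin 3 → ℝ) : Prop :=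
  (vertexMatrix P)ᵀ * hollowMatrix h * vertexMatrix P = -diagonal ![a ^ 2, b ^ 2, -1]

/-- Of the six entries, the first three give the axes, the next two place the centre at the origin,
and the last is the normalization. -/
theorem isDualForm_iff {a b : ℝ} {P : Fin 3 → Plane} {h : Fin 3 → ℝ} :
    IsDualForm a b P h ↔
      2 * (h 0 * (P 1 0 * P 2 0) + h 1 * (P 2 0 * P 0 0) + h 2 * (P 0 0 * P 1 0)) = -a ^ 2 ∧
      2 * (h 0 * (P 1 1 * P 2 1) + h 1 * (P 2 1 * P 0 1) + h 2 * (P 0 1 * P 1 1)) = -b ^ 2 ∧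
      h 0 * (P 1 0 * P 2 1 + P 2 0 * P 1 1) + h 1 * (P 2 0 * P 0 1 + P 0 0 * P 2 1) +
        h 2 * (P 0 0 * P 1 1 + P 1 0 * P 0 1) = 0 ∧
      h 0 * (P 1 0 + P 2 0) + h 1 * (P 2 0 + P 0 0) + h 2 * (P 0 0 + P 1 0) = 0 ∧
      h 0 * (P 1 1 + P 2 1) + h 1 * (P 2 1 + P 0 1) + h 2 * (P 0 1 + P 1 1) = 0 ∧
      2 * (h 0 + h 1 + h 2) = 1 := by
  rw [IsDualForm, ← Matrix.ext_iff]
  constructor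
  · intro H
    have h00 := H 0 0
    have h01 := H 0 1
    have h11 := H 1 1
    have h02 := H 0 2
    have h12 := H 1 2
    have h22 := H 2 2
    simp [vertexMatrix, hollowMatrix, Matrix.mul_apply, Fin.sum_univ_three]
      at h00 h01 h11 h02 h12 h22
    refine ⟨?_, ?_, ?_, ?_, ?_, ?_⟩ <;> linarith
  · rintro ⟨h1, h2, h3, h4, h5, h6⟩ i j
    fin_cases i <;> fin_cases j <;>
      simp [vertexMatrix, hollowMatrix, Matrix.mul_apply, Fin.sum_univ_three] <;> linarith

/-- The inverse of the negative of a hollow matrix. -/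
noncomputable def hollowInverse (h : Fin 3 → ℝ) : Matrix (Fin 3) (Fin 3) ℝ :=
  !![h 0 / (2 * h 1 * h 2), -1 / (2 * h 2), -1 / (2 * h 1);
    -1 / (2 * h 2), h 1 / (2 * h 2 * h 0), -1 / (2 * h 0);
    -1 / (2 * h 1), -1 / (2 * h 0), h 2 / (2 * h 0 * h 1)]

theorem hollowInverse_mul {h : Fin 3 → ℝ} (hh : ∀ i, h i ≠ 0) :
    hollowInverse h * hollowMatrix h = -1 := by
  have h0 := hh 0
  have h1 := hh 1
  have h2 := hh 2
  ext i j
  fin_cases i <;> fin_cases j <;>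
    simp [hollowInverse, hollowMatrix, Matrix.mul_apply, Fin.sum_univ_three] <;> field_simp <;>
    norm_num

theorem isDualForm_iff_gram {a b : ℝ} (ha : 0 < a) (hb : 0 < b) {P : Fin 3 → Plane}
    {h : Fin 3 → ℝ} (hh : ∀ i, h i ≠ 0) :
    IsDualForm a b P h ↔ ∀ i j, conicForm a b (P i) (P j) = hollowInverse h i j := by
  have hE := diagonal_mul_diagonal_inv (pow_ne_zero 2 ha.ne') (pow_ne_zero 2 hb.ne')
    (neg_ne_zero.2 (one_ne_zero (α := ℝ)))
  rw [IsDualForm, ← gram_eq_iff hE (hollowInverse_mul hh), ← Matrix.ext_iff]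
  refine forall_congr' fun i => forall_congr' fun j => ?_
  rw [vertexMatrix_gram, conicForm]
  constructor <;> intro h <;> rw [← h] <;> ring

theorem conicForm_comm (a b : ℝ) (X Y : Plane) : conicForm a b X Y = conicForm a b Y X := by
  rw [conicForm, conicForm, mul_comm (X 0), mul_comm (X 1)]

theorem det_gram_ne_zero {a b : ℝ} (ha : 0 < a) (hb : 0 < b) {P : Fin 3 → Plane}
    (hP : doubleArea P ≠ 0) :
    (Matrix.of fun i j => conicForm a b (P i) (P j)).det ≠ 0 := by
  have : (Matrix.of fun i j => conicForm a b (P i) (P j)) =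
      vertexMatrix P * diagonal ![1 / a ^ 2, 1 / b ^ 2, -1] * (vertexMatrix P)ᵀ := by
    ext i j
    rw [vertexMatrix_gram, of_apply, conicForm]
    ring
  rw [this, det_mul, det_mul, det_transpose, det_diagonal, Fin.prod_univ_three]
  change doubleArea P * _ * doubleArea P ≠ 0
  refine mul_ne_zero (mul_ne_zero hP ?_) hP
  have h1 : 1 / a ^ 2 ≠ 0 := by positivity
  have h2 : 1 / b ^ 2 ≠ 0 := by positivity
  simpa using And.intro ha.ne' hb.ne'

/-- The row of a vertex in the Gram matrix of a nondegenerate triangle does not vanish. -/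
theorem conicForm_self_ne_zero {a b : ℝ} (ha : 0 < a) (hb : 0 < b) {P : Fin 3 → Plane}
    (hP : doubleArea P ≠ 0)
    (h : ∀ i j, conicForm a b (P i) (P j) ^ 2 =
      conicForm a b (P i) (P i) * conicForm a b (P j) (P j)) (i : Fin 3) :
    conicForm a b (P i) (P i) ≠ 0 := by
  intro h0
  refine det_gram_ne_zero ha hb hP (det_eq_zero_of_row_eq_zero i fun j => ?_)
  have := h i j
  rw [h0, zero_mul] at this
  exact pow_eq_zero_iff two_ne_zero |>.1 this

/-- An ellipse whose three contact points lie inside the sides of a triangle has a dual form with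
positive entries. -/
theorem isDualForm_of_contact {a b : ℝ} (ha : 0 < a) (hb : 0 < b) {P : Fin 3 → Plane}
    (hP : doubleArea P ≠ 0) (t : Fin 3 → ℝ) (ht0 : ∀ i, 0 ≤ t i) (ht1 : ∀ i, t i ≤ 1)
    (h1 : ∀ i, (1 - t i) * conicForm a b (P (i + 1)) (P (i + 1)) +
      t i * conicForm a b (P (i + 1)) (P (i + 2)) = 0)
    (h2 : ∀ i, (1 - t i) * conicForm a b (P (i + 1)) (P (i + 2)) +
      t i * conicForm a b (P (i + 2)) (P (i + 2)) = 0) :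
    (∀ i, conicForm a b (P (i + 1)) (P (i + 2)) < 0) ∧
      IsDualForm a b P fun i => -1 / (2 * conicForm a b (P (i + 1)) (P (i + 2))) := by
  -- The vector (1 - t, t) is a nonzero kernel vector of the Gram matrix of the side, whose
  -- determinant is therefore 0.
  have hsq' : ∀ i, conicForm a b (P (i + 1)) (P (i + 2)) ^ 2 =
      conicForm a b (P (i + 1)) (P (i + 1)) * conicForm a b (P (i + 2)) (P (i + 2)) := by
    intro i
    have e1 := h1 i
    have e2 := h2 i
    set x := conicForm a b (P (i + 1)) (P (i + 1))
    set y := conicForm a b (P (i + 1)) (P (i + 2))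
    set z := conicForm a b (P (i + 2)) (P (i + 2))
    have f1 : t i * (y ^ 2 - x * z) = 0 := by linear_combination y * e1 - x * e2
    have f2 : (1 - t i) * (y ^ 2 - x * z) = 0 := by linear_combination y * e2 - z * e1
    linear_combination f1 + f2
  have hsq : ∀ i j, conicForm a b (P i) (P j) ^ 2 =
      conicForm a b (P i) (P i) * conicForm a b (P j) (P j) := by
    have q0 := hsq' 0
    have q1 := hsq' 1
    have q2 := hsq' 2
    simp only [Fin.isValue, zero_add, show (1 : Fin 3) + 1 = 2 from rfl,
      show (1 : Fin 3) + 2 = 0 from rfl, show (2 : Fin 3) + 1 = 0 from rfl,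
      show (2 : Fin 3) + 2 = 1 from rfl] at q0 q1 q2
    intro i j
    fin_cases i <;> fin_cases j <;> simp only [Fin.zero_eta, Fin.mk_one, Fin.reduceFinMk]
    · ring
    · exact q2
    · rw [conicForm_comm, q1]; ring
    · rw [conicForm_comm, q2]; ring
    · ring
    · exact q0
    · exact q1
    · rw [conicForm_comm, q0]; ring
    · ring
  have hne := conicForm_self_ne_zero ha hb hP hsq
  have hneg : ∀ i, conicForm a b (P (i + 1)) (P (i + 2)) < 0 ∧
      0 < conicForm a b (P (i + 1)) (P (i + 1)) := by
    intro i
    have e1 := h1 i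
    have e2 := h2 i
    have e3 := hsq' i
    have n1 := hne (i + 1)
    have n2 := hne (i + 2)
    have hN : 0 ≤ conicForm a b (P (i + 1)) (P (i + 1)) -
        2 * conicForm a b (P (i + 1)) (P (i + 2)) + conicForm a b (P (i + 2)) (P (i + 2)) := by
      have : conicForm a b (P (i + 1)) (P (i + 1)) -
        2 * conicForm a b (P (i + 1)) (P (i + 2)) + conicForm a b (P (i + 2)) (P (i + 2)) =
        (P (i + 1) 0 - P (i + 2) 0) ^ 2 / a ^ 2 + (P (i + 1) 1 - P (i + 2) 1) ^ 2 / b ^ 2 := by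
        simp only [conicForm]
        ring
      rw [this]
      positivity
    have t0 := ht0 i
    have t1 := ht1 i
    set x := conicForm a b (P (i + 1)) (P (i + 1))
    set y := conicForm a b (P (i + 1)) (P (i + 2))
    set z := conicForm a b (P (i + 2)) (P (i + 2))
    have hy : y ≠ 0 := by
      intro hy
      rw [hy, zero_pow two_ne_zero] at e3
      exact mul_ne_zero n1 n2 e3.symm
    have ht0' : t i ≠ 0 := by
      intro h
      rw [h] at e1
      exact n1 (by linarith)
    have ht1' : 1 - t i ≠ 0 := by
      intro h
      rw [h] at e2
      have : t i = 1 := by linarith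
      rw [this] at e2
      exact n2 (by linarith)
    have t0' : 0 < t i := lt_of_le_of_ne t0 (Ne.symm ht0')
    have t1' : 0 < 1 - t i := lt_of_le_of_ne (by linarith) (Ne.symm ht1')
    -- If y were positive, the contact equations would make x and z negative, contradicting x - 2y +
    -- z ≥ 0.
    have hy0 : y < 0 := by
      by_contra hcon
      have hy0 : 0 < y := lt_of_le_of_ne (not_lt.1 hcon) (Ne.symm hy)
      have hx : x < 0 := by
        by_contra hx
        have : 0 ≤ (1 - t i) * x := mul_nonneg t1'.le (not_lt.1 hx)
        have : 0 < t i * y := mul_pos t0' hy0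
        linarith
      have hz : z < 0 := by
        by_contra hz
        have : 0 ≤ t i * z := mul_nonneg t0 (not_lt.1 hz)
        have : 0 < (1 - t i) * y := mul_pos t1' hy0
        linarith
      linarith
    refine ⟨hy0, ?_⟩
    by_contra hx
    have : (1 - t i) * x ≤ 0 := mul_nonpos_of_nonneg_of_nonpos t1'.le (not_lt.1 hx)
    have : t i * y < 0 := mul_neg_of_pos_of_neg t0' hy0
    linarith
  refine ⟨fun i => (hneg i).1, ?_⟩
  rw [isDualForm_iff_gram ha hb fun i => by
    have := (hneg i).1
    exact div_ne_zero (by norm_num) (by linarith)]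
  -- The three vanishing minors give this identity up to sign; the signs just found decide it. It
  -- supplies the diagonal entries of `hollowInverse`.
  have hprod : ∀ i, conicForm a b (P i) (P (i + 1)) * conicForm a b (P i) (P (i + 2)) =
      -(conicForm a b (P i) (P i) * conicForm a b (P (i + 1)) (P (i + 2))) := by
    intro i
    have q1 := hsq i (i + 1)
    have q2 := hsq i (i + 2)
    have q3 := hsq (i + 1) (i + 2)
    have n0 := (hneg i).1
    have n1 := (hneg (i + 1)).1
    have n2 := (hneg (i + 2))
    have c1 : i + 1 + 1 = i + 2 := by fin_cases i <;> rfl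
    have c2 : i + 1 + 2 = i := by fin_cases i <;> rfl
    have c3 : i + 2 + 1 = i := by fin_cases i <;> rfl
    have c4 : i + 2 + 2 = i + 1 := by fin_cases i <;> rfl
    rw [c1, c2, conicForm_comm] at n1
    rw [c3, c4] at n2
    set x := conicForm a b (P i) (P i)
    set u := conicForm a b (P i) (P (i + 1))
    set v := conicForm a b (P i) (P (i + 2))
    set y := conicForm a b (P (i + 1)) (P (i + 2))
    have h1 : 0 < u * v := mul_pos_of_neg_of_neg n2.1 n1
    have h2 : 0 < -(x * y) := by
      have := mul_neg_of_pos_of_neg n2.2 n0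
      linarith
    have h3 : (u * v - -(x * y)) * (u * v + -(x * y)) = 0 := by
      linear_combination v ^ 2 * q1 + x * conicForm a b (P (i + 1)) (P (i + 1)) * q2 - x ^ 2 * q3
    rcases mul_eq_zero.1 h3 with h | h
    · linarith
    · linarith
  have p0 := hprod 0
  have p1 := hprod 1
  have p2 := hprod 2
  have n0 := (hneg 0).1.ne
  have n1 := (hneg 1).1.ne
  have n2 := (hneg 2).1.ne
  simp only [Fin.isValue, zero_add, show (1 : Fin 3) + 1 = 2 from rfl,
    show (1 : Fin 3) + 2 = 0 from rfl, show (2 : Fin 3) + 1 = 0 from rfl,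
    show (2 : Fin 3) + 2 = 1 from rfl] at p0 p1 p2 n0 n1 n2
  intro i j
  rw [conicForm_comm a b (P 1) (P 0)] at p1
  rw [conicForm_comm a b (P 2) (P 1)] at p2
  rw [conicForm_comm a b (P 0) (P 2)] at p0
  fin_cases i <;> fin_cases j <;> simp [hollowInverse, show (1 : Fin 3) + 1 = 2 from rfl,
    show (1 : Fin 3) + 2 = 0 from rfl, show (2 : Fin 3) + 2 = 1 from rfl]
  · field_simp
    linear_combination p0
  · field_simp
  · rw [conicForm_comm]
    field_simp
  · rw [conicForm_comm]
    field_simp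
  · field_simp
    linear_combination p1
  · field_simp
  · field_simp
  · rw [conicForm_comm]
    field_simp
  · field_simp
    linear_combination p2

/-! ### Relations between the dual form and the circumcircle -/

theorem IsDualForm.prod_eq {a b : ℝ} {P : Fin 3 → Plane} {h : Fin 3 → ℝ}
    (H : IsDualForm a b P h) : 2 * (h 0 * h 1 * h 2) * doubleArea P ^ 2 = a ^ 2 * b ^ 2 := by
  have h1 := congrArg det H
  rw [det_mul, det_mul, det_transpose, det_neg, det_diagonal, Fin.prod_univ_three] at h1
  have h2 : (hollowMatrix h).det = 2 * (h 0 * h 1 * h 2) := by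
    simp [hollowMatrix, det_fin_three]
    ring
  rw [h2] at h1
  simp at h1
  rw [doubleArea]
  linear_combination h1

/-- The matrix of the power with respect to the circle with centre `(u, v)` and radius `R`. -/
def circleMatrix (u v R : ℝ) : Matrix (Fin 3) (Fin 3) ℝ :=
  !![1, 0, -u; 0, 1, -v; -u, -v, u ^ 2 + v ^ 2 - R ^ 2]

/-- The power form of a circle, polarized at two of its points, is minus half their squared
distance. -/
theorem circleMatrix_gram {P : Fin 3 → Plane} {u v R : ℝ}
    (hC : ∀ i, (P i 0 - u) ^ 2 + (P i 1 - v) ^ 2 = R ^ 2) :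
    vertexMatrix P * circleMatrix u v R * (vertexMatrix P)ᵀ =
      hollowMatrix fun i => -(sideSq P i / 2) := by
  have h0 := hC 0
  have h1 := hC 1
  have h2 := hC 2
  ext i j
  fin_cases i <;> fin_cases j <;>
    simp [vertexMatrix, circleMatrix, hollowMatrix, Matrix.mul_apply, Fin.sum_univ_three,
      sideSq_zero, sideSq_one, sideSq_two] <;> linarith

theorem sideSq_prod_eq {P : Fin 3 → Plane} {u v R : ℝ}
    (hC : ∀ i, (P i 0 - u) ^ 2 + (P i 1 - v) ^ 2 = R ^ 2) :
    sideSq P 0 * sideSq P 1 * sideSq P 2 = 4 * R ^ 2 * doubleArea P ^ 2 := by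
  have h1 := congrArg det (circleMatrix_gram hC)
  rw [det_mul, det_mul, det_transpose] at h1
  have h2 : (circleMatrix u v R).det = -R ^ 2 := by
    simp [circleMatrix, det_fin_three]
    ring
  have h3 : (hollowMatrix fun i => -(sideSq P i / 2)).det =
      -(sideSq P 0 * sideSq P 1 * sideSq P 2) / 4 := by
    simp [hollowMatrix, det_fin_three]
    ring
  rw [h2, h3] at h1
  rw [doubleArea]
  linear_combination 4 * h1

/-- This is the trace pairing of the circle with the dual conic, evaluated in barycentric and in
Cartesian coordinates. -/
theorem IsDualForm.sum_eq {a b : ℝ} {P : Fin 3 → Plane} {h : Fin 3 → ℝ}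
    (H : IsDualForm a b P h) {u v R : ℝ}
    (hC : ∀ i, (P i 0 - u) ^ 2 + (P i 1 - v) ^ 2 = R ^ 2) :
    h 0 * sideSq P 0 + h 1 * sideSq P 1 + h 2 * sideSq P 2 =
      a ^ 2 + b ^ 2 + R ^ 2 - u ^ 2 - v ^ 2 := by
  obtain ⟨h1, h2, -, h4, h5, h6⟩ := isDualForm_iff.1 H
  have c0 := hC 0
  have c1 := hC 1
  have c2 := hC 2
  rw [sideSq_zero, sideSq_one, sideSq_two]
  linear_combination h 0 * (c1 + c2) + h 1 * (c2 + c0) + h 2 * (c0 + c1) - h1 - h2 +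
    2 * u * h4 + 2 * v * h5 + (R ^ 2 - u ^ 2 - v ^ 2) * h6

theorem heron (P : Fin 3 → Plane) :
    sideSqSum P ^ 2 = 4 * (sideSq P 0 * sideSq P 1 + sideSq P 1 * sideSq P 2 +
      sideSq P 2 * sideSq P 0) - 4 * doubleArea P ^ 2 := by
  rw [sideSqSum, sideSq_zero, sideSq_one, sideSq_two, doubleArea_eq]
  ring

/-- Inserting h i = w / sᵢ, where sᵢ are the squared sides, into the normalization evaluates the sum
of the products sᵢsⱼ in Heron's formula through R and the area. -/
theorem IsDualForm.shape_eq {a b : ℝ} {P : Fin 3 → Plane} {h : Fin 3 → ℝ}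
    (H : IsDualForm a b P h) {u v R w : ℝ}
    (hC : ∀ i, (P i 0 - u) ^ 2 + (P i 1 - v) ^ 2 = R ^ 2) (hw : ∀ i, h i * sideSq P i = w) :
    sideSqSum P ^ 2 * w = (8 * R ^ 2 - 4 * w) * doubleArea P ^ 2 := by
  obtain ⟨-, -, -, -, -, h6⟩ := isDualForm_iff.1 H
  have hs := sideSq_prod_eq hC
  have h0 := hw 0
  have h1 := hw 1
  have h2 := hw 2
  rw [heron]
  linear_combination 2 * hs + 2 * sideSq P 0 * sideSq P 1 * sideSq P 2 * h6 -
    4 * sideSq P 1 * sideSq P 2 * h0 - 4 * sideSq P 2 * sideSq P 0 * h1 -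
    4 * sideSq P 0 * sideSq P 1 * h2

/-! ### Triangles over a Brocard pair in standard position -/

/-- The equality case of AM-GM for three numbers. -/
theorem eq_of_sum_eq_of_prod_eq {x y z m : ℝ} (hx : 0 < x) (hy : 0 < y) (hz : 0 < z)
    (hs : x + y + z = 3 * m) (hp : x * y * z = m ^ 3) : x = m ∧ y = m ∧ z = m := by
  have key : (x + y + z) * ((x - y) ^ 2 + (y - z) ^ 2 + (z - x) ^ 2) / 2 +
      3 * (x * (y - z) ^ 2 + y * (z - x) ^ 2 + z * (x - y) ^ 2) = 0 := by
    have : (x + y + z) ^ 3 - 27 * (x * y * z) = 0 := by rw [hs, hp]; ring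
    linear_combination this
  have h1 : 0 ≤ 3 * (x * (y - z) ^ 2 + y * (z - x) ^ 2 + z * (x - y) ^ 2) := by positivity
  have h2 : (x - y) ^ 2 + (y - z) ^ 2 + (z - x) ^ 2 ≤ 0 := by
    by_contra h
    have : 0 < (x + y + z) * ((x - y) ^ 2 + (y - z) ^ 2 + (z - x) ^ 2) :=
      mul_pos (by positivity) (not_le.1 h)
    linarith
  have hxy : (x - y) ^ 2 = 0 := by
    linarith [sq_nonneg (x - y), sq_nonneg (y - z), sq_nonneg (z - x)]
  have hyz : (y - z) ^ 2 = 0 := by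
    linarith [sq_nonneg (x - y), sq_nonneg (y - z), sq_nonneg (z - x)]
  have e1 := sub_eq_zero.1 (pow_eq_zero_iff two_ne_zero |>.1 hxy)
  have e2 := sub_eq_zero.1 (pow_eq_zero_iff two_ne_zero |>.1 hyz)
  exact ⟨by linarith, by linarith, by linarith⟩

theorem mem_sphere_iff_coord {X O : Plane} {R : ℝ} (hR : 0 ≤ R) :
    X ∈ Metric.sphere O R ↔ (X 0 - O 0) ^ 2 + (X 1 - O 1) ^ 2 = R ^ 2 := by
  rw [Metric.mem_sphere, ← dist_sq_eq, sq_eq_sq₀ dist_nonneg hR]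

theorem mem_brocardCircle_iff {a b : ℝ} (hb : 0 < b) {X : Plane} :
    X ∈ brocardCircle a b ↔ (X 0 - 0) ^ 2 +
      (X 1 - -(√(a ^ 2 - b ^ 2) * √(4 * a ^ 2 - b ^ 2) / b)) ^ 2 = (2 * a ^ 2 / b) ^ 2 := by
  rw [brocardCircle, mem_sphere_iff_coord (by positivity)]
  simp

/-- Nothing is assumed about the symmedian point: AM-GM forces every such triangle to have the
ellipse as its Brocard inellipse. Positivity, needed for AM-GM, holds because the ellipse lies in
the closed disc, so its contact points lie on the sides themselves. -/
theorem hasShape_of_mem_threePeriodics {a b : ℝ} (hb : 0 < b) (hab : b ≤ a) {P : Fin 3 → Plane}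
    (hP : P ∈ threePeriodics (brocardCircle a b) (ellipse a b)) :
    HasShape (16 * (a / b) ^ 2 - 4) P := by
  have ha : 0 < a := hb.trans_le hab
  obtain ⟨hI, hO, hT⟩ := hP
  have hA := affineIndependent_iff_doubleArea_ne_zero.1 hI
  have hC := fun i => (mem_brocardCircle_iff hb).1 (hO i)
  have hc2 : √(a ^ 2 - b ^ 2) ^ 2 = a ^ 2 - b ^ 2 := Real.sq_sqrt (by nlinarith)
  have he2 : √(4 * a ^ 2 - b ^ 2) ^ 2 = 4 * a ^ 2 - b ^ 2 := Real.sq_sqrt (by nlinarith)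
  set c := √(a ^ 2 - b ^ 2)
  set e := √(4 * a ^ 2 - b ^ 2)
  choose D hD using hT
  have hD' := fun i => (tangentAt_sideline_iff ha hb hA).1 (hD i)
  choose t ht1 ht2 hD0 hD1 using fun i => exists_contact_parameter (hD' i).1 (hD' i).2.1 (hD' i).2.2
  -- The power of the contact point with respect to the circle is minus a perfect square, by double
  -- contact, and also minus t(1 - t) times the squared side.
  have htt : ∀ i, 0 ≤ t i * (1 - t i) := by
    intro i
    have hell : conicForm a b (D i) (D i) = 0 := by
      apply mem_ellipse_iff.1
      have : D i ∈ (sideline P i : Set Plane) ∩ ellipse a b := by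
        rw [show (sideline P i : Set Plane) ∩ ellipse a b = {D i} from hD i]
        rfl
      exact this.2
    have hpow : D i 0 ^ 2 + (D i 1 + c * e / b) ^ 2 - (2 * a ^ 2 / b) ^ 2 =
        -(c * D i 1 / b - e) ^ 2 := by
      rw [conicForm] at hell
      have h1 : D i 0 ^ 2 = a ^ 2 * (1 - D i 1 ^ 2 / b ^ 2) := by
        field_simp at hell ⊢
        linear_combination hell
      rw [h1]
      field_simp
      linear_combination (D i 1 ^ 2 + e ^ 2) * hc2 + a ^ 2 * he2
    have hpow' : D i 0 ^ 2 + (D i 1 + c * e / b) ^ 2 - (2 * a ^ 2 / b) ^ 2 =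
        -(t i * (1 - t i) * sideSq P i) := by
      have c1 := hC (i + 1)
      have c2 := hC (i + 2)
      rw [sideSq, dist_sq_eq, hD0 i, hD1 i]
      linear_combination (1 - t i) * c1 + t i * c2
    have hs := sideSq_pos hA i
    by_contra hcon
    have := mul_neg_of_neg_of_pos (not_le.1 hcon) hs
    linarith [sq_nonneg (c * D i 1 / b - e)]
  have ht0 : ∀ i, 0 ≤ t i := fun i => by nlinarith [htt i]
  have ht1' : ∀ i, t i ≤ 1 := fun i => by nlinarith [htt i]
  obtain ⟨hneg, H⟩ := isDualForm_of_contact ha hb hA t ht0 ht1' ht1 ht2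
  set h : Fin 3 → ℝ := fun i => -1 / (2 * conicForm a b (P (i + 1)) (P (i + 2))) with hh
  have hpos : ∀ i, 0 < h i := fun i =>
    div_pos_of_neg_of_neg (by norm_num) (by linarith [hneg i])
  have hsum := H.sum_eq hC
  have hprod := H.prod_eq
  have hsides := sideSq_prod_eq hC
  have hw : ∀ i, 0 < h i * sideSq P i := fun i => mul_pos (hpos i) (sideSq_pos hA i)
  have hS : h 0 * sideSq P 0 + h 1 * sideSq P 1 + h 2 * sideSq P 2 = 3 * (2 * a ^ 2) := by
    rw [hsum]
    field_simp
    linear_combination -e ^ 2 * hc2 - (a ^ 2 - b ^ 2) * he2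
  have hPr : h 0 * sideSq P 0 * (h 1 * sideSq P 1) * (h 2 * sideSq P 2) = (2 * a ^ 2) ^ 3 := by
    have hA2 : 2 * doubleArea P ^ 2 ≠ 0 := by positivity
    apply mul_left_cancel₀ hA2
    have hR : b ^ 2 * (2 * a ^ 2 / b) ^ 2 = 4 * a ^ 4 := by
      field_simp
      ring
    linear_combination sideSq P 0 * sideSq P 1 * sideSq P 2 * hprod + a ^ 2 * b ^ 2 * hsides +
      4 * a ^ 2 * doubleArea P ^ 2 * hR
  obtain ⟨w0, w1, w2⟩ := eq_of_sum_eq_of_prod_eq (hw 0) (hw 1) (hw 2) hS hPr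
  have hsh := H.shape_eq hC (w := 2 * a ^ 2) (by
    intro i
    fin_cases i
    exacts [w0, w1, w2])
  refine ⟨hA, ?_⟩
  apply mul_right_cancel₀ (show 2 * a ^ 2 ≠ 0 by positivity)
  rw [hsh]
  field_simp
  ring

/-! ### The Brocard inellipse in standard position -/

theorem doubleArea_eq_cross (P : Fin 3 → Plane) (i : Fin 3) :
    doubleArea P = (P (i + 1) 0 - P i 0) * (P (i + 2) 1 - P i 1) -
      (P (i + 1) 1 - P i 1) * (P (i + 2) 0 - P i 0) := by
  rw [doubleArea_eq]
  fin_cases i <;> simp [show (1 : Fin 3) + 1 = 2 from rfl, show (1 : Fin 3) + 2 = 0 from rfl,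
    show (2 : Fin 3) + 2 = 1 from rfl] <;> ring

theorem sum_eq_cyclic (f : Fin 3 → ℝ) (i : Fin 3) : ∑ j, f j = f i + f (i + 1) + f (i + 2) := by
  rw [Fin.sum_univ_three]
  fin_cases i <;> simp [show (1 : Fin 3) + 1 = 2 from rfl, show (1 : Fin 3) + 2 = 0 from rfl,
    show (2 : Fin 3) + 2 = 1 from rfl] <;> ring

theorem symmedianPoint_coord (P : Fin 3 → Plane) (hP : doubleArea P ≠ 0) (i k : _) :
    (sideSq P i + sideSq P (i + 1) + sideSq P (i + 2)) * symmedianPoint P k =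
      sideSq P i * P i k + sideSq P (i + 1) * P (i + 1) k + sideSq P (i + 2) * P (i + 2) k := by
  have hL : ∑ j, sideSq P j ≠ 0 :=
    (Finset.sum_pos (fun j _ => sideSq_pos hP j) Finset.univ_nonempty).ne'
  rw [← sum_eq_cyclic (fun j => sideSq P j) i, ← sum_eq_cyclic (fun j => sideSq P j * P j k) i,
    symmedianPoint]
  simp [Finset.sum_apply]
  field_simp

/-- The symmedian foot is the mean of the two vertices weighted by their opposite squared sides, so
the contact parameter must be s2 / (s1 + s2). -/
theorem brocardFoot_iff {a b : ℝ} (ha : 0 < a) (hb : 0 < b) {P : Fin 3 → Plane}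
    (hP : doubleArea P ≠ 0) :
    (∀ i, ∃ D, D ∈ line[ℝ, P i, symmedianPoint P] ∧ TangentAt (sideline P i) (ellipse a b) D) ↔
    ∀ i, sideSq P (i + 1) * conicForm a b (P (i + 1)) (P (i + 1)) +
        sideSq P (i + 2) * conicForm a b (P (i + 1)) (P (i + 2)) = 0 ∧
      sideSq P (i + 1) * conicForm a b (P (i + 1)) (P (i + 2)) +
        sideSq P (i + 2) * conicForm a b (P (i + 2)) (P (i + 2)) = 0 := by
  refine forall_congr' fun i => ?_
  have hK0 := symmedianPoint_coord P hP i 0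
  have hK1 := symmedianPoint_coord P hP i 1
  have hA := doubleArea_eq_cross P i
  have hs0 := sideSq_pos hP i
  have hs1 := sideSq_pos hP (i + 1)
  have hs2 := sideSq_pos hP (i + 2)
  set K := symmedianPoint P
  set s0 := sideSq P i
  set s1 := sideSq P (i + 1)
  set s2 := sideSq P (i + 2)
  constructor
  · rintro ⟨D, hD, hT⟩
    obtain ⟨h1, h2, h3⟩ := (tangentAt_sideline_iff ha hb hP).1 hT
    obtain ⟨τ, e0, e1⟩ := mem_line_iff.1 hD
    obtain ⟨t, f1, f2, g0, g1⟩ := exists_contact_parameter h1 h2 h3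
    -- The contact point is collinear with the vertex and the symmedian point, so a cross product
    -- vanishes.
    have hts : ((1 - t) * s2 - t * s1) * doubleArea P = 0 := by
      have hx : (D 0 - P i 0) * (K 1 - P i 1) - (D 1 - P i 1) * (K 0 - P i 0) = 0 := by
        rw [e0, e1]
        ring
      rw [g0, g1] at hx
      rw [hA]
      linear_combination (s0 + s1 + s2) * hx -
        (P (i + 1) 0 + t * (P (i + 2) 0 - P (i + 1) 0) - P i 0) * hK1 +
        (P (i + 1) 1 + t * (P (i + 2) 1 - P (i + 1) 1) - P i 1) * hK0
    have ht : (1 - t) * s2 - t * s1 = 0 := (mul_eq_zero.1 hts).resolve_right hP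
    have hsum : s1 + s2 ≠ 0 := by positivity
    have ht' : t = s2 / (s1 + s2) := by
      rw [eq_div_iff hsum]
      linear_combination -ht
    rw [ht'] at f1 f2
    field_simp at f1 f2
    constructor
    · linear_combination f1
    · linear_combination f2
  · rintro ⟨f1, f2⟩
    have hsum : s1 + s2 ≠ 0 := by positivity
    refine ⟨!₂[(s1 * P (i + 1) 0 + s2 * P (i + 2) 0) / (s1 + s2),
      (s1 * P (i + 1) 1 + s2 * P (i + 2) 1) / (s1 + s2)], mem_line_iff.2
        ⟨(s0 + s1 + s2) / (s1 + s2), ?_, ?_⟩, (tangentAt_sideline_iff ha hb hP).2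
        ⟨mem_line_iff.2 ⟨s2 / (s1 + s2), ?_, ?_⟩, ?_, ?_⟩⟩
    · simp only [Matrix.cons_val_zero]
      field_simp
      linear_combination -hK0
    · simp only [Matrix.cons_val_one, Matrix.cons_val_fin_one]
      field_simp
      linear_combination -hK1
    · simp only [Matrix.cons_val_zero]
      field_simp
      ring
    · simp only [Matrix.cons_val_one, Matrix.cons_val_fin_one]
      field_simp
      ring
    · simp only [conicForm, Matrix.cons_val_zero, Matrix.cons_val_one] at f1 ⊢
      field_simp at f1 ⊢
      linear_combination f1
    · simp only [conicForm, Matrix.cons_val_zero, Matrix.cons_val_one] at f2 ⊢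
      field_simp at f2 ⊢
      linear_combination f2

/-- The foot conditions make the mixed values of the conic form at two vertices proportional to the
opposite squared sides, and the dual entries are reciprocals of these values up to a constant. -/
theorem exists_isDualForm_of_brocardFoot {a b : ℝ} (ha : 0 < a) (hb : 0 < b) {P : Fin 3 → Plane}
    (hP : doubleArea P ≠ 0)
    (hB : ∀ i, ∃ D, D ∈ line[ℝ, P i, symmedianPoint P] ∧
      TangentAt (sideline P i) (ellipse a b) D) :
    ∃ w, 0 < w ∧ IsDualForm a b P fun i => w / sideSq P i := by
  rw [brocardFoot_iff ha hb hP] at hB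
  have hs := sideSq_pos hP
  obtain ⟨hneg, H⟩ := isDualForm_of_contact ha hb hP
    (fun i => sideSq P (i + 2) / (sideSq P (i + 1) + sideSq P (i + 2)))
    (fun i => by have := hs (i + 1); have := hs (i + 2); positivity)
    (fun i => by
      have := hs (i + 1)
      have := hs (i + 2)
      rw [div_le_one (by positivity)]
      linarith)
    (fun i => by
      have := hs (i + 1)
      have := hs (i + 2)
      field_simp
      linear_combination (hB i).1)
    (fun i => by
      have := hs (i + 1)
      have := hs (i + 2)
      field_simp
      linear_combination (hB i).2)
  have h0 := hB 0
  have h1 := hB 1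
  have h2 := hB 2
  have n0 := hneg 0
  have n1 := hneg 1
  have n2 := hneg 2
  have s0 := hs 0
  have s1 := hs 1
  have s2 := hs 2
  simp only [Fin.isValue, zero_add, show (1 : Fin 3) + 1 = 2 from rfl,
    show (1 : Fin 3) + 2 = 0 from rfl, show (2 : Fin 3) + 1 = 0 from rfl,
    show (2 : Fin 3) + 2 = 1 from rfl] at h0 h1 h2 n0 n1 n2
  have e1 : sideSq P 0 * conicForm a b (P 2) (P 0) = sideSq P 1 * conicForm a b (P 1) (P 2) := by
    linear_combination h1.1 - h0.2
  have e2 : sideSq P 0 * conicForm a b (P 0) (P 1) = sideSq P 2 * conicForm a b (P 1) (P 2) := by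
    linear_combination h2.2 - h0.1
  refine ⟨-sideSq P 0 / (2 * conicForm a b (P 1) (P 2)),
    div_pos_of_neg_of_neg (by linarith) (by linarith), ?_⟩
  convert H using 1
  funext i
  have m0 := n0.ne
  have m1 := n1.ne
  have m2 := n2.ne
  fin_cases i <;> simp [show (1 : Fin 3) + 1 = 2 from rfl,
    show (1 : Fin 3) + 2 = 0 from rfl, show (2 : Fin 3) + 2 = 1 from rfl]
  · field_simp
  · field_simp
    linear_combination -e1
  · field_simp
    linear_combination -e2

/-- The circumcircle of a triangle is bitangent to its Brocard inellipse, which determines it. -/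
theorem IsDualForm.circumcircle_eq {a b w : ℝ} (hb : 0 < b) (hab : b ≤ a) {P : Fin 3 → Plane}
    (hP : doubleArea P ≠ 0) (hw : 0 < w) (H : IsDualForm a b P fun i => w / sideSq P i)
    {u v R : ℝ} (hR : 0 ≤ R) (hC : ∀ i, (P i 0 - u) ^ 2 + (P i 1 - v) ^ 2 = R ^ 2) :
    w = 2 * a ^ 2 ∧ u = 0 ∧ R = 2 * a ^ 2 / b ∧
      v ^ 2 = (√(a ^ 2 - b ^ 2) * √(4 * a ^ 2 - b ^ 2) / b) ^ 2 := by
  have ha : 0 < a := hb.trans_le hab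
  have hs := sideSq_pos hP
  have hgram := (isDualForm_iff_gram ha hb fun i => (div_pos hw (hs i)).ne').1 H
  have hsides := sideSq_prod_eq hC
  have hprod := H.prod_eq
  have s0 := hs 0
  have s1 := hs 1
  have s2 := hs 2
  have hu : IsUnit (vertexMatrix P).det := isUnit_iff_ne_zero.2 hP
  have hut : IsUnit (vertexMatrix P)ᵀ.det := by rwa [det_transpose]
  set V := vertexMatrix P with hV
  obtain ⟨ρ, hρ⟩ : ∃ ρ : ℝ, ρ ^ 2 = sideSq P 0 * sideSq P 1 * sideSq P 2 :=
    ⟨_, Real.sq_sqrt (by positivity)⟩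
  -- With this z the barycentric matrix of the circle minus w/2 times that of the ellipse is -z zᵀ.
  -- The vector l is the line z in Cartesian coordinates, the chord of contact.
  set z : Fin 3 → ℝ := fun i => ρ / (2 * sideSq P i) with hz
  set l := V⁻¹ *ᵥ z with hl
  have hVl : V *ᵥ l = z := by rw [hl, mulVec_mulVec, mul_nonsing_inv V hu, one_mulVec]
  set N := circleMatrix u v R - (w / 2) • diagonal ![1 / a ^ 2, 1 / b ^ 2, -1] + vecMulVec l l
    with hN
  have hzero : V * N * Vᵀ = 0 := by
    have h1 : V * N * Vᵀ = V * circleMatrix u v R * Vᵀ -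
        (w / 2) • (V * diagonal ![1 / a ^ 2, 1 / b ^ 2, -1] * Vᵀ) + vecMulVec z z := by
      rw [hN, mul_add, mul_sub, add_mul, sub_mul, Matrix.mul_smul, Matrix.smul_mul, mul_vecMulVec,
        vecMulVec_mul, vecMul_transpose, hVl]
    have h2 : V * diagonal ![1 / a ^ 2, 1 / b ^ 2, -1] * Vᵀ =
        hollowInverse fun i => w / sideSq P i := by
      ext i j
      rw [← hgram i j, hV, vertexMatrix_gram, conicForm]
      ring
    rw [h1, h2, circleMatrix_gram hC]
    ext i j
    fin_cases i <;> fin_cases j <;>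
      simp [hollowMatrix, hollowInverse, vecMulVec_apply, hz] <;> field_simp <;>
      linear_combination hρ
  have hN0 : N = 0 := by
    calc N = V⁻¹ * (V * N * Vᵀ) * Vᵀ⁻¹ := by
          rw [mul_assoc V, nonsing_inv_mul_cancel_left _ _ hu, mul_nonsing_inv_cancel_right _ _ hut]
      _ = 0 := by rw [hzero, mul_zero, zero_mul]
  have n00 := congrFun (congrFun hN0 0) 0
  have n11 := congrFun (congrFun hN0 1) 1
  have n22 := congrFun (congrFun hN0 2) 2
  have n01 := congrFun (congrFun hN0 0) 1
  have n02 := congrFun (congrFun hN0 0) 2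
  have n12 := congrFun (congrFun hN0 1) 2
  simp [hN, circleMatrix, vecMulVec_apply] at n00 n11 n22 n01 n02 n12
  -- The mixed entry gives l 0 * l 1 = 0. If l 1 = 0, then w = 2b² and (l 0)² a² = b² - a² ≤ 0, so l
  -- 0 = 0 in any case.
  have hl0 : l 0 = 0 := by
    rcases n01 with h | h
    · exact h
    · rw [h] at n11
      have e1 : w = 2 * b ^ 2 := by
        field_simp at n11
        linarith
      rw [e1] at n00
      have e2 : l 0 * l 0 * a ^ 2 = b ^ 2 - a ^ 2 := by
        field_simp at n00
        linarith
      have e3 : b ^ 2 ≤ a ^ 2 := pow_le_pow_left₀ hb.le hab 2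
      have e4 : 0 ≤ l 0 * l 0 := mul_self_nonneg _
      have e5 : l 0 * l 0 * a ^ 2 = 0 := le_antisymm (by linarith) (by positivity)
      have e6 : a ^ 2 ≠ 0 := by positivity
      simpa [e6] using e5
  rw [hl0] at n00 n02
  have hwa : w = 2 * a ^ 2 := by
    field_simp at n00
    linarith
  have hu0 : u = 0 := by linarith
  have hR2 : R ^ 2 = (2 * a ^ 2 / b) ^ 2 := by
    -- Comparing the determinant formulas for the dual form and for the circle yields R.
    have h1 : 2 * w ^ 3 * doubleArea P ^ 2 =
        a ^ 2 * b ^ 2 * (4 * R ^ 2 * doubleArea P ^ 2) := by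
      rw [← hsides, ← hprod]
      field_simp
    have h2 : doubleArea P ^ 2 ≠ 0 := pow_ne_zero 2 hP
    have h3 : 2 * w ^ 3 = a ^ 2 * b ^ 2 * (4 * R ^ 2) := by
      apply mul_right_cancel₀ h2
      linear_combination h1
    rw [hwa] at h3
    have h4 : a ^ 2 ≠ 0 := by positivity
    field_simp
    apply mul_left_cancel₀ h4
    linear_combination -h3 / 4
  refine ⟨hwa, hu0, (pow_left_inj₀ hR (by positivity) two_ne_zero).1 hR2, ?_⟩
  have hc2 : √(a ^ 2 - b ^ 2) ^ 2 = a ^ 2 - b ^ 2 := Real.sq_sqrt (by nlinarith)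
  have he2 : √(4 * a ^ 2 - b ^ 2) ^ 2 = 4 * a ^ 2 - b ^ 2 := Real.sq_sqrt (by nlinarith)
  rw [div_pow, mul_pow, hc2, he2]
  rw [hu0, hR2, hwa] at n22
  rw [hwa] at n11
  have hv : v ^ 2 = (l 1 * l 1) * (l 2 * l 2) := by
    have : v = l 1 * l 2 := by linarith
    rw [this]
    ring
  have g1 : l 1 * l 1 = a ^ 2 / b ^ 2 - 1 := by
    field_simp at n11 ⊢
    linarith
  have g2 : l 2 * l 2 = (2 * a ^ 2 / b) ^ 2 - a ^ 2 - v ^ 2 := by linarith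
  rw [g1, g2] at hv
  field_simp at hv ⊢
  have h4 : a ^ 2 ≠ 0 := by positivity
  apply mul_left_cancel₀ h4
  linear_combination hv

theorem IsDualForm.brocardFoot {a b w : ℝ} (ha : 0 < a) (hb : 0 < b) {P : Fin 3 → Plane}
    (hP : doubleArea P ≠ 0) (hw : 0 < w) (H : IsDualForm a b P fun i => w / sideSq P i) :
    ∀ i, ∃ D, D ∈ line[ℝ, P i, symmedianPoint P] ∧
      TangentAt (sideline P i) (ellipse a b) D := by
  rw [brocardFoot_iff ha hb hP]
  have hs := sideSq_pos hP
  have hgram := (isDualForm_iff_gram ha hb fun i => (div_pos hw (hs i)).ne').1 H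
  have s0 := hs 0
  have s1 := hs 1
  have s2 := hs 2
  intro i
  simp only [hgram]
  fin_cases i <;> simp [hollowInverse, show (1 : Fin 3) + 1 = 2 from rfl,
    show (1 : Fin 3) + 2 = 0 from rfl, show (2 : Fin 3) + 2 = 1 from rfl] <;> field_simp <;>
    norm_num

/-! ### Existence of the Brocard inellipse -/

/-- Eliminating x 2 through the centre condition completes the squares. Hence the axes of a conic
with positive dual entries are real. -/
theorem dual_quadratic_nonpos {h x : Fin 3 → ℝ} (hh : ∀ i, 0 < h i)
    (hx : h 0 * (x 1 + x 2) + h 1 * (x 2 + x 0) + h 2 * (x 0 + x 1) = 0) :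
    2 * (h 0 * (x 1 * x 2) + h 1 * (x 2 * x 0) + h 2 * (x 0 * x 1)) ≤ 0 := by
  have h0 := hh 0
  have h1 := hh 1
  have h2 := hh 2
  have key : (h 0 + h 1) * (2 * (h 0 * (x 1 * x 2) + h 1 * (x 2 * x 0) + h 2 * (x 0 * x 1))) =
      -2 * ((h 1 * x 0 + h 0 * x 1) ^ 2 + h 1 * h 2 * x 0 ^ 2 + h 0 * h 2 * x 1 ^ 2) := by
    linear_combination 2 * (h 0 * x 1 + h 1 * x 0) * hx
  have : 0 ≤ (h 1 * x 0 + h 0 * x 1) ^ 2 + h 1 * h 2 * x 0 ^ 2 + h 0 * h 2 * x 1 ^ 2 := by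
    positivity
  by_contra hcon
  have := mul_pos (add_pos h0 h1) (not_le.1 hcon)
  linarith

/-- Every triangle has a Brocard inellipse: take dual entries w / sᵢ with sᵢ the squared sides,
normalize them by the choice of w, move the centre (mx, my) to the origin and rotate to the axes. -/
theorem exists_map_isDualForm {P : Fin 3 → Plane} (hP : doubleArea P ≠ 0) :
    ∃ S, IsDirectSimilarity S ∧ ∃ a b w : ℝ, 0 < b ∧ b ≤ a ∧ 0 < w ∧
      IsDualForm a b (S ∘ P) fun i => w / sideSq (S ∘ P) i := by
  have hs := sideSq_pos hP
  have s0 := hs 0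
  have s1 := hs 1
  have s2 := hs 2
  set w := 1 / (2 * (1 / sideSq P 0 + 1 / sideSq P 1 + 1 / sideSq P 2)) with hwdef
  have hw : 0 < w := by positivity
  set h : Fin 3 → ℝ := fun i => w / sideSq P i with hh
  have hpos : ∀ i, 0 < h i := fun i => div_pos hw (hs i)
  have hone : 2 * (h 0 + h 1 + h 2) = 1 := by
    simp only [hh, hwdef]
    field_simp
  set mx := h 0 * (P 1 0 + P 2 0) + h 1 * (P 2 0 + P 0 0) + h 2 * (P 0 0 + P 1 0) with hmx
  set my := h 0 * (P 1 1 + P 2 1) + h 1 * (P 2 1 + P 0 1) + h 2 * (P 0 1 + P 1 1) with hmy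
  set p := mx ^ 2 - 2 * (h 0 * (P 1 0 * P 2 0) + h 1 * (P 2 0 * P 0 0) + h 2 * (P 0 0 * P 1 0))
    with hp
  set r := my ^ 2 - 2 * (h 0 * (P 1 1 * P 2 1) + h 1 * (P 2 1 * P 0 1) + h 2 * (P 0 1 * P 1 1))
    with hr
  set q := mx * my - (h 0 * (P 1 0 * P 2 1 + P 2 0 * P 1 1) +
    h 1 * (P 2 0 * P 0 1 + P 0 0 * P 2 1) + h 2 * (P 0 0 * P 1 1 + P 1 0 * P 0 1)) with hq
  obtain ⟨c, s, hcs, hoff, hord⟩ := exists_rotation_diagonal p q r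
  let S : Plane → Plane := fun X =>
    !₂[c * X 0 - s * X 1 + (-(c * mx) + s * my), s * X 0 + c * X 1 + (-(s * mx) - c * my)]
  have hSdef : ∀ X, S X = !₂[c * X 0 - s * X 1 + (-(c * mx) + s * my),
    s * X 0 + c * X 1 + (-(s * mx) - c * my)] := fun X => rfl
  have hS : IsDirectSimilarity S :=
    isDirectSimilarity_iff.2 ⟨c, s, _, _, by rw [hcs]; exact one_ne_zero, hSdef⟩
  have hside : ∀ i, sideSq (S ∘ P) i = sideSq P i := fun i => by
    rw [sideSq_map hSdef, hcs, one_mul]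
  have harea : doubleArea (S ∘ P) = doubleArea P := by rw [doubleArea_map hSdef, hcs, one_mul]
  set Q := S ∘ P with hQdef
  have Q0 : ∀ i, Q i 0 = c * (P i 0 - mx) - s * (P i 1 - my) := fun i => by
    simp [Q, S]; ring
  have Q1 : ∀ i, Q i 1 = s * (P i 0 - mx) + c * (P i 1 - my) := fun i => by
    simp [Q, S]; ring
  have cx : h 0 * ((P 1 0 - mx) + (P 2 0 - mx)) + h 1 * ((P 2 0 - mx) + (P 0 0 - mx)) +
      h 2 * ((P 0 0 - mx) + (P 1 0 - mx)) = 0 := by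
    linear_combination -mx * hone - hmx
  have cy : h 0 * ((P 1 1 - my) + (P 2 1 - my)) + h 1 * ((P 2 1 - my) + (P 0 1 - my)) +
      h 2 * ((P 0 1 - my) + (P 1 1 - my)) = 0 := by
    linear_combination -my * hone - hmy
  have hp' : 2 * (h 0 * ((P 1 0 - mx) * (P 2 0 - mx)) + h 1 * ((P 2 0 - mx) * (P 0 0 - mx)) +
      h 2 * ((P 0 0 - mx) * (P 1 0 - mx))) = -p := by
    linear_combination mx ^ 2 * hone + hp + 2 * mx * hmx
  have hr' : 2 * (h 0 * ((P 1 1 - my) * (P 2 1 - my)) + h 1 * ((P 2 1 - my) * (P 0 1 - my)) +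
      h 2 * ((P 0 1 - my) * (P 1 1 - my))) = -r := by
    linear_combination my ^ 2 * hone + hr + 2 * my * hmy
  have hq' : h 0 * ((P 1 0 - mx) * (P 2 1 - my) + (P 2 0 - mx) * (P 1 1 - my)) +
      h 1 * ((P 2 0 - mx) * (P 0 1 - my) + (P 0 0 - mx) * (P 2 1 - my)) +
      h 2 * ((P 0 0 - mx) * (P 1 1 - my) + (P 1 0 - mx) * (P 0 1 - my)) = -q := by
    linear_combination mx * my * hone + hq + my * hmx + mx * hmy
  set A := c ^ 2 * p - 2 * c * s * q + s ^ 2 * r with hA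
  set B := s ^ 2 * p + 2 * c * s * q + c ^ 2 * r with hB
  have k1 : 2 * (h 0 * (Q 1 0 * Q 2 0) + h 1 * (Q 2 0 * Q 0 0) + h 2 * (Q 0 0 * Q 1 0)) = -A := by
    simp only [Q0]
    linear_combination c ^ 2 * hp' - 2 * c * s * hq' + s ^ 2 * hr' - hA
  have k2 : 2 * (h 0 * (Q 1 1 * Q 2 1) + h 1 * (Q 2 1 * Q 0 1) + h 2 * (Q 0 1 * Q 1 1)) = -B := by
    simp only [Q1]
    linear_combination s ^ 2 * hp' + 2 * c * s * hq' + c ^ 2 * hr' - hB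
  have k3 : h 0 * (Q 1 0 * Q 2 1 + Q 2 0 * Q 1 1) + h 1 * (Q 2 0 * Q 0 1 + Q 0 0 * Q 2 1) +
      h 2 * (Q 0 0 * Q 1 1 + Q 1 0 * Q 0 1) = 0 := by
    simp only [Q0, Q1]
    linear_combination c * s * hp' + (c ^ 2 - s ^ 2) * hq' - c * s * hr' - hoff
  have k4 : h 0 * (Q 1 0 + Q 2 0) + h 1 * (Q 2 0 + Q 0 0) + h 2 * (Q 0 0 + Q 1 0) = 0 := by
    simp only [Q0]
    linear_combination c * cx - s * cy
  have k5 : h 0 * (Q 1 1 + Q 2 1) + h 1 * (Q 2 1 + Q 0 1) + h 2 * (Q 0 1 + Q 1 1) = 0 := by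
    simp only [Q1]
    linear_combination s * cx + c * cy
  have hA0 : 0 ≤ A := by
    have := dual_quadratic_nonpos (x := fun i => Q i 0) hpos k4
    linarith
  have hB0 : 0 ≤ B := by
    have := dual_quadratic_nonpos (x := fun i => Q i 1) hpos k5
    linarith
  have H : IsDualForm √A √B Q h := by
    rw [isDualForm_iff, Real.sq_sqrt hA0, Real.sq_sqrt hB0]
    exact ⟨k1, k2, k3, k4, k5, hone⟩
  have hprod := H.prod_eq
  rw [Real.sq_sqrt hA0, Real.sq_sqrt hB0, harea] at hprod
  -- Only A, B ≥ 0 is known so far; the determinant makes them nonzero.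
  have hAB : 0 < A * B := by
    rw [← hprod]
    have := hpos 0
    have := hpos 1
    have := hpos 2
    positivity
  have hBpos : 0 < B := pos_of_mul_pos_right hAB hA0
  refine ⟨S, hS, √A, √B, w, Real.sqrt_pos.2 hBpos, Real.sqrt_le_sqrt hord, hw, ?_⟩
  convert H using 1
  exact funext fun i => congrArg (w / ·) (hside i)

/-! ### Normal forms of Brocard pairs -/

theorem exists_circumcircle {P : Fin 3 → Plane} (hP : doubleArea P ≠ 0) :
    ∃ u v R : ℝ, 0 ≤ R ∧ ∀ i, (P i 0 - u) ^ 2 + (P i 1 - v) ^ 2 = R ^ 2 := by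
  let T : Affine.Simplex ℝ Plane 2 := ⟨P, affineIndependent_iff_doubleArea_ne_zero.2 hP⟩
  refine ⟨T.circumcenter 0, T.circumcenter 1, T.circumradius, T.circumradius_nonneg, fun i => ?_⟩
  rw [← dist_sq_eq, ← T.dist_circumcenter_eq_circumradius i]

theorem placedEllipse_zero (a b : ℝ) : placedEllipse 0 0 a b = ellipse a b := by
  ext X
  have : rot (-0) (X - 0) = X := by apply plane_ext <;> simp [rot]
  simp only [placedEllipse, Set.mem_ofPred_eq, this]

theorem mem_ellipse_scale {a b m : ℝ} (hm : m ≠ 0) {X Y : Plane} {ε : ℝ} (hε : ε ^ 2 = 1)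
    (h0 : Y 0 = ε * m * X 0) (h1 : Y 1 = ε * m * X 1) :
    Y ∈ ellipse (m * a) (m * b) ↔ X ∈ ellipse a b := by
  have e0 : (Y 0 / (m * a)) ^ 2 = (X 0 / a) ^ 2 := by
    rw [h0, mul_comm ε, mul_assoc, mul_div_mul_left _ _ hm, div_pow, mul_pow, hε, one_mul, div_pow]
  have e1 : (Y 1 / (m * b)) ^ 2 = (X 1 / b) ^ 2 := by
    rw [h1, mul_comm ε, mul_assoc, mul_div_mul_left _ _ hm, div_pow, mul_pow, hε, one_mul, div_pow]
  simp only [ellipse, Set.mem_ofPred_eq, e0, e1]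

theorem brocardCentre_scale {a b m : ℝ} (hm : 0 < m) :
    √((m * a) ^ 2 - (m * b) ^ 2) * √(4 * (m * a) ^ 2 - (m * b) ^ 2) / (m * b) =
      m * (√(a ^ 2 - b ^ 2) * √(4 * a ^ 2 - b ^ 2) / b) := by
  have h1 : (m * a) ^ 2 - (m * b) ^ 2 = m ^ 2 * (a ^ 2 - b ^ 2) := by ring
  have h2 : 4 * (m * a) ^ 2 - (m * b) ^ 2 = m ^ 2 * (4 * a ^ 2 - b ^ 2) := by ring
  rw [h1, h2, Real.sqrt_mul (sq_nonneg m), Real.sqrt_mul (sq_nonneg m), Real.sqrt_sq hm.le]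
  field_simp

/-- A sign that moves the circumcentre to the lower half of the minor axis. -/
theorem exists_sign_mul_eq_neg {v d : ℝ} (h : v ^ 2 = d ^ 2) :
    ∃ ε : ℝ, ε ^ 2 = 1 ∧ ε * v = -d := by
  rcases sq_eq_sq_iff_eq_or_eq_neg.1 h with h | h
  · exact ⟨-1, by norm_num, by rw [h]; ring⟩
  · exact ⟨1, by norm_num, by rw [h]; ring⟩

theorem exists_map_isBrocardInellipse {β k : ℝ} (hβ : 1 ≤ β) (hk : 0 < k) {P : Fin 3 → Plane}
    (hP : HasShape (16 * β ^ 2 - 4) P) :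
    ∃ S, IsDirectSimilarity S ∧ (∀ i, (S ∘ P) i ∈ brocardCircle (k * β) k) ∧
      IsBrocardInellipse (S ∘ P) (ellipse (k * β) k) := by
  obtain ⟨S, hS, a, b, w, hb, hab, hw, H⟩ := exists_map_isDualForm hP.1
  have hQ := (hasShape_map hS).2 hP
  have ha : 0 < a := hb.trans_le hab
  set Q := S ∘ P with hQdef
  have hs := sideSq_pos hQ.1
  obtain ⟨u, v, R, hR, hC⟩ := exists_circumcircle hQ.1
  obtain ⟨hwa, hu, hRa, hv⟩ := H.circumcircle_eq hb hab hQ.1 hw hR hC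
  have hsh := H.shape_eq hC (w := w) fun i => div_mul_cancel₀ _ (hs i).ne'
  -- The axis ratio of the Brocard inellipse is a function of κ.
  have hβa : β = a / b := by
    have h1 : (16 * β ^ 2 - 4) * w = 8 * R ^ 2 - 4 * w := by
      apply mul_right_cancel₀ (pow_ne_zero 2 hQ.1)
      rw [← hsh, hQ.2]
      ring
    rw [hwa, hRa] at h1
    have h2 : β ^ 2 = (a / b) ^ 2 := by
      have h3 : a ^ 2 ≠ 0 := by positivity
      field_simp at h1 ⊢
      linarith
    exact (pow_left_inj₀ (by linarith) (by positivity) two_ne_zero).1 h2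
  set m := k / b with hm
  have hm0 : 0 < m := by positivity
  have hkβ : k * β = m * a := by rw [hβa, hm]; ring
  have hkm : k = m * b := by rw [hm]; field_simp
  obtain ⟨ε, hε, hεv⟩ := exists_sign_mul_eq_neg hv
  -- For ε = -1 this includes a half turn, which is direct, preserves centred ellipses and exchanges
  -- the two possible circumcentres.
  let T : Plane → Plane := fun X => !₂[ε * m * X 0 - 0 * X 1 + 0, 0 * X 0 + ε * m * X 1 + 0]
  have T0 : ∀ X, T X 0 = ε * m * X 0 := fun X => by simp [T]
  have T1 : ∀ X, T X 1 = ε * m * X 1 := fun X => by simp [T]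
  have hT : IsDirectSimilarity T := by
    refine isDirectSimilarity_iff.2 ⟨ε * m, 0, 0, 0, ?_, fun X => rfl⟩
    rw [mul_pow, hε]
    positivity
  have hpre : T ⁻¹' ellipse (k * β) k = ellipse a b := by
    ext X
    rw [hkβ]
    nth_rewrite 1 [hkm]
    exact mem_ellipse_scale hm0.ne' hε (T0 X) (T1 X)
  refine ⟨T ∘ S, hT.comp hS, fun i => ?_, ⟨0, 0, k * β, k, hk, ?_, (placedEllipse_zero _ _).symm⟩,
    ?_⟩
  · rw [mem_brocardCircle_iff hk]
    have hd : √((k * β) ^ 2 - k ^ 2) * √(4 * (k * β) ^ 2 - k ^ 2) / k = -(m * (ε * v)) := by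
      rw [hkβ]
      nth_rewrite 1 2 3 [hkm]
      rw [brocardCentre_scale hm0, hεv]
      ring
    have hr : 2 * (k * β) ^ 2 / k = m * R := by
      rw [hkβ, hRa]
      nth_rewrite 1 [hkm]
      field_simp
    rw [hd, hr]
    change (T (Q i) 0 - 0) ^ 2 + (T (Q i) 1 - _) ^ 2 = _
    rw [T0, T1]
    have := hC i
    rw [hu] at this
    linear_combination m ^ 2 * this + m ^ 2 * ((Q i 0) ^ 2 + (Q i 1 - v) ^ 2) * hε
  · nlinarith
  · have := (brocardFoot_map hT hQ.1 (E := ellipse (k * β) k)).2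
    rw [hpre] at this
    exact this (H.brocardFoot ha hb hQ.1 hw)

/-- Once the ellipse is in standard position its circle is determined up to a half turn, so every
Brocard pair is congruent to a standard one. -/
theorem IsBrocardPair.exists_preimage_eq {C : Set Plane} {M : Plane} {φ a b : ℝ} (hb : 0 < b)
    (hab : b ≤ a) (h : IsBrocardPair C (placedEllipse M φ a b)) :
    ∃ S, IsDirectSimilarity S ∧ S ⁻¹' brocardCircle a b = C ∧
      S ⁻¹' ellipse a b = placedEllipse M φ a b := by
  have ha : 0 < a := hb.trans_le hab
  obtain ⟨⟨O, R, rfl⟩, P, hI, hO, -, hF⟩ := h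
  have hP := affineIndependent_iff_doubleArea_ne_zero.1 hI
  have hR : 0 ≤ R := by
    rw [← Metric.mem_sphere.1 (hO 0)]
    exact dist_nonneg
  let S : Plane → Plane := fun X => rot (-φ) (X - M)
  have hS : IsDirectSimilarity S := ⟨1, one_pos, -φ, M, fun X => (one_smul _ _).symm⟩
  have hcs := Real.sin_sq_add_cos_sq φ
  have hdist : ∀ X Y, (S X 0 - S Y 0) ^ 2 + (S X 1 - S Y 1) ^ 2 =
      (X 0 - Y 0) ^ 2 + (X 1 - Y 1) ^ 2 := by
    intro X Y
    simp [S, rot]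
    linear_combination ((X 0 - Y 0) ^ 2 + (X 1 - Y 1) ^ 2) * hcs
  have hpre : S ⁻¹' ellipse a b = placedEllipse M φ a b := rfl
  have hQ : doubleArea (S ∘ P) ≠ 0 :=
    affineIndependent_iff_doubleArea_ne_zero.1 ((affineIndependent_map hS).2 hI)
  have hF' := (brocardFoot_map hS hP (E := ellipse a b)).2 (by rw [hpre]; exact hF)
  obtain ⟨w, hw, H⟩ := exists_isDualForm_of_brocardFoot ha hb hQ hF'
  have hC : ∀ i, ((S ∘ P) i 0 - S O 0) ^ 2 + ((S ∘ P) i 1 - S O 1) ^ 2 = R ^ 2 := fun i => by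
    rw [Function.comp, hdist]
    exact (mem_sphere_iff_coord hR).1 (hO i)
  obtain ⟨-, hu, hRa, hv⟩ := H.circumcircle_eq hb hab hQ hw hR hC
  obtain ⟨ε, hε, hεv⟩ := exists_sign_mul_eq_neg hv
  let T : Plane → Plane := fun X => !₂[ε * X 0 - 0 * X 1 + 0, 0 * X 0 + ε * X 1 + 0]
  have T0 : ∀ X, T X 0 = ε * X 0 := fun X => by simp [T]
  have T1 : ∀ X, T X 1 = ε * X 1 := fun X => by simp [T]
  have hT : IsDirectSimilarity T :=
    isDirectSimilarity_iff.2 ⟨ε, 0, 0, 0, by rw [hε]; norm_num, fun X => rfl⟩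
  refine ⟨T ∘ S, hT.comp hS, ?_, ?_⟩
  · ext X
    rw [Set.mem_preimage, mem_brocardCircle_iff hb, mem_sphere_iff_coord hR, ← hdist, hu, ← hRa,
      ← hεv, Function.comp, T0, T1]
    constructor <;> intro h
    · linear_combination h - ((S X 0 - 0) ^ 2 + (S X 1 - S O 1) ^ 2) * hε
    · linear_combination h + ((S X 0 - 0) ^ 2 + (S X 1 - S O 1) ^ 2) * hε
  · rw [← hpre]
    ext X
    have := mem_ellipse_scale (a := a) (b := b) one_ne_zero (X := S X) (Y := T (S X)) hε
      (by rw [T0, mul_one]) (by rw [T1, mul_one])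
    rwa [one_mul, one_mul] at this

theorem mem_threePeriodics_of_isBrocardInellipse {C E : Set Plane} {P : Fin 3 → Plane}
    (hP : AffineIndependent ℝ P) (hC : ∀ i, P i ∈ C) (hE : IsBrocardInellipse P E) :
    P ∈ threePeriodics C E :=
  ⟨hP, hC, fun i => let ⟨D, _, hD⟩ := hE.2 i; ⟨D, hD⟩⟩

/-! ### The two axis ratios -/

theorem betaRatio_sq {a b : ℝ} (ha : 0 < a) (hb : 0 < b) :
    16 * betaRatio a b ^ 2 - 4 = 3 * (a ^ 2 + b ^ 2) ^ 2 / (a ^ 2 * b ^ 2) := by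
  rw [betaRatio, div_pow, Real.sq_sqrt (by positivity)]
  field_simp
  ring

theorem one_le_betaRatio {a b : ℝ} (ha : 0 < a) (hb : 0 < b) : 1 ≤ betaRatio a b := by
  rw [betaRatio, le_div_iff₀ (by positivity), one_mul]
  apply Real.le_sqrt_of_sq_le
  nlinarith [sq_nonneg (a ^ 2 - b ^ 2)]

theorem one_le_sigmaRatio {a b : ℝ} (hb : 0 < b) (hab : b ≤ a) : 1 ≤ sigmaRatio a b := by
  rw [sigmaRatio, Real.one_le_sqrt, le_div_iff₀ (by positivity)]
  have h1 := Real.sqrt_nonneg (4 * a ^ 4 - 5 * a ^ 2 * b ^ 2 + b ^ 4)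
  nlinarith

/-- With r = a/b, σ² is the larger root of 3x² + (10 - 16r²)x + 3 = 0, which is the equality of the
two values of κ. -/
theorem sigmaRatio_shape {a b : ℝ} (hb : 0 < b) (hab : b ≤ a) {k : ℝ} (hk : 0 < k) :
    3 * ((k * sigmaRatio a b) ^ 2 + k ^ 2) ^ 2 / ((k * sigmaRatio a b) ^ 2 * k ^ 2) =
      16 * (a / b) ^ 2 - 4 := by
  have hσ := one_le_sigmaRatio hb hab
  have hba : b ^ 2 ≤ a ^ 2 := pow_le_pow_left₀ hb.le hab 2
  have hq : √(4 * a ^ 4 - 5 * a ^ 2 * b ^ 2 + b ^ 4) ^ 2 =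
      4 * a ^ 4 - 5 * a ^ 2 * b ^ 2 + b ^ 4 := by
    apply Real.sq_sqrt
    nlinarith [mul_nonneg (sub_nonneg.2 hba) (show 0 ≤ 4 * a ^ 2 - b ^ 2 by nlinarith)]
  have hσ2 : sigmaRatio a b ^ 2 =
      (8 * a ^ 2 - 5 * b ^ 2 + 4 * √(4 * a ^ 4 - 5 * a ^ 2 * b ^ 2 + b ^ 4)) / (3 * b ^ 2) := by
    rw [sigmaRatio, Real.sq_sqrt]
    have h1 := Real.sqrt_nonneg (4 * a ^ 4 - 5 * a ^ 2 * b ^ 2 + b ^ 4)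
    apply div_nonneg _ (by positivity)
    nlinarith
  set q := √(4 * a ^ 4 - 5 * a ^ 2 * b ^ 2 + b ^ 4)
  set σ := sigmaRatio a b
  have hσ0 : 0 < σ := by linarith
  rw [eq_div_iff (by positivity)] at hσ2
  have h4q : 4 * q = σ ^ 2 * (3 * b ^ 2) - 8 * a ^ 2 + 5 * b ^ 2 := by linarith
  have h16 : (4 * q) ^ 2 = 16 * (4 * a ^ 4 - 5 * a ^ 2 * b ^ 2 + b ^ 4) := by
    rw [mul_pow, hq]
    norm_num
  rw [h4q] at h16
  have hb2 : b ^ 2 ≠ 0 := by positivity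
  field_simp
  apply mul_left_cancel₀ hb2
  linear_combination h16 / 3

/-- An affine image of an equilateral triangle. It supplies the triangle required to show that the
standard pair over β is a Brocard pair. -/
theorem homotheticFamily_nonempty {a b : ℝ} (ha : 0 < a) (hb : 0 < b) :
    (homotheticFamily a b).Nonempty := by
  have h3 : √3 ^ 2 = (3 : ℝ) := Real.sq_sqrt (by norm_num)
  refine ⟨![!₂[a, 0], !₂[-a / 2, √3 / 2 * b], !₂[-a / 2, -(√3 / 2 * b)]],
    (mem_homotheticFamily_iff ha hb).2 ⟨?_, ?_, ?_, ?_, ?_⟩⟩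
  · simp
    ring
  · simp
  · simp
  · simp
    ring
  · simp
    linear_combination b ^ 2 / 2 * h3

end Porism

/-! ### The two correspondences, by matching κ. -/

theorem mainTheorem5 :
    -- from a homothetic pair to the Brocard porisms with inellipse semi-axes `(k * β, k)`
    (∀ a b : ℝ, 0 < a → 0 < b → ∀ k : ℝ, 0 < k →
      IsBrocardPair (brocardCircle (k * betaRatio a b) k) (ellipse (k * betaRatio a b) k) ∧
      (∀ P ∈ homotheticFamily a b, ∃ S : Plane → Plane, IsDirectSimilarity S ∧
        S ∘ P ∈ threePeriodics (brocardCircle (k * betaRatio a b) k)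
          (ellipse (k * betaRatio a b) k) ∧
        IsBrocardInellipse (S ∘ P) (ellipse (k * betaRatio a b) k)) ∧
      (∀ Q ∈ threePeriodics (brocardCircle (k * betaRatio a b) k) (ellipse (k * betaRatio a b) k),
        ∃ P ∈ homotheticFamily a b, ∃ S : Plane → Plane, IsDirectSimilarity S ∧ S ∘ P = Q)) ∧
    -- from a Brocard porism to the homothetic pairs with outer semi-axes `(k * σ, k)`
    (∀ (C : Set Plane) (M : Plane) (φ a b : ℝ), 0 < b → b ≤ a →
      IsBrocardPair C (placedEllipse M φ a b) → ∀ k : ℝ, 0 < k →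
      (∀ Q ∈ threePeriodics C (placedEllipse M φ a b), ∃ S : Plane → Plane, IsDirectSimilarity S ∧
        S ∘ Q ∈ homotheticFamily (k * sigmaRatio a b) k ∧
        IsSteinerCircumellipse (S ∘ Q) (ellipse (k * sigmaRatio a b) k)) ∧
      (∀ P ∈ homotheticFamily (k * sigmaRatio a b) k,
        ∃ Q ∈ threePeriodics C (placedEllipse M φ a b),
          ∃ S : Plane → Plane, IsDirectSimilarity S ∧ S ∘ Q = P)) := by
  constructor
  · intro a b ha hb k hk
    have hβ := one_le_betaRatio ha hb
    have key : ∀ P ∈ homotheticFamily a b, ∃ S : Plane → Plane, IsDirectSimilarity S ∧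
        S ∘ P ∈ threePeriodics (brocardCircle (k * betaRatio a b) k)
          (ellipse (k * betaRatio a b) k) ∧
        IsBrocardInellipse (S ∘ P) (ellipse (k * betaRatio a b) k) := by
      intro P hP
      have hsh := hasShape_of_mem_homotheticFamily ha hb hP
      rw [← betaRatio_sq ha hb] at hsh
      obtain ⟨S, hS, hC, hE⟩ := exists_map_isBrocardInellipse hβ hk hsh
      exact ⟨S, hS, mem_threePeriodics_of_isBrocardInellipse
        ((affineIndependent_map hS).2 hP.1) hC hE, hE⟩
    refine ⟨?_, key, ?_⟩
    · obtain ⟨P, hP⟩ := homotheticFamily_nonempty ha hb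
      obtain ⟨S, -, hT, hE⟩ := key P hP
      exact ⟨⟨_, _, rfl⟩, S ∘ P, hT.1, hT.2.1, hE⟩
    · intro Q hQ
      have hsh := hasShape_of_mem_threePeriodics hk (by nlinarith) hQ
      rw [mul_div_cancel_left₀ _ hk.ne', betaRatio_sq ha hb] at hsh
      obtain ⟨S, hS, hP⟩ := exists_map_mem_homotheticFamily ha hb hsh
      obtain ⟨T, hT, hTS, -⟩ := hS.exists_inverse
      exact ⟨S ∘ Q, hP, T, hT, funext fun i => hTS (Q i)⟩
  · intro C M φ a b hb hab hCE k hk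
    have hσ := one_le_sigmaRatio hb hab
    have hkσ : 0 < k * sigmaRatio a b := mul_pos hk (by linarith)
    have hshape := sigmaRatio_shape hb hab hk
    obtain ⟨S₀, hS₀, rfl, hE⟩ := hCE.exists_preimage_eq hb hab
    rw [← hE]
    constructor
    · intro Q hQ
      have hsh := (hasShape_map hS₀).1
        (hasShape_of_mem_threePeriodics hb hab ((threePeriodics_map hS₀).2 hQ))
      rw [← hshape] at hsh
      obtain ⟨S, hS, hP⟩ := exists_map_mem_homotheticFamily hkσ hk hsh
      refine ⟨S, hS, hP, ⟨0, k * sigmaRatio a b, k, hk, by nlinarith, ?_⟩, hP.2.1⟩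
      obtain ⟨hx, hy, -⟩ := (mem_homotheticFamily_iff hkσ hk).1 hP
      have hc : (3 : ℝ)⁻¹ • ∑ i, (S ∘ Q) i = 0 := by
        rw [Fin.sum_univ_three]
        apply plane_ext
        · simp only [Function.comp] at hx
          simp
          linear_combination hx / 3
        · simp only [Function.comp] at hy
          simp
          linear_combination hy / 3
      rw [hc, placedEllipse_zero]
    · intro P hP
      have hsh := hasShape_of_mem_homotheticFamily hkσ hk hP
      rw [hshape] at hsh
      -- Axis ratio a / b and scale b: the target is then exactly the standard pair with semi-axes
      -- a, b.
      obtain ⟨S, hS, hC, hB⟩ :=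
        exists_map_isBrocardInellipse ((one_le_div hb).2 hab) hb hsh
      rw [mul_div_cancel₀ _ hb.ne'] at hB
      simp only [mul_div_cancel₀ _ hb.ne'] at hC
      have hT := mem_threePeriodics_of_isBrocardInellipse
        ((affineIndependent_map hS).2 hP.1) hC hB
      obtain ⟨T₀, hT₀, -, hST₀⟩ := hS₀.exists_inverse
      obtain ⟨T, hT', hTS, -⟩ := hS.exists_inverse
      refine ⟨T₀ ∘ S ∘ P, (threePeriodics_map hS₀).1 ?_, T ∘ S₀, hT'.comp hS₀, ?_⟩
      · have : S₀ ∘ T₀ ∘ S ∘ P = S ∘ P := funext fun i => hST₀ (S (P i))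
        rwa [this]
      · funext i
        change T (S₀ (T₀ (S (P i)))) = P i
        rw [hST₀, hTS]
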